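/- Let $f:\mathbb{R}^n\to\mathbb{R}$ be convex and differentiable with $L_f$-Lipschitz gradient ($L_f>0$), let $\mathcal{C}\subseteq\mathbb{R}^n$ be compact and convex, and let $g_1,\dots,g_m:\mathbb{R}^n\to\mathbb{R}$ be convex and differentiable, where $\nabla g_i$ is Lipschitz on $\mathcal{C}$ with constant $L_{g_i}>0$. Consider $$\min_{x\in\mathbb{R}^n} f(x)+h(x)\quad\text{s.t.}\quad g(x):=(g_1(x),\dots,g_m(x))\le 0,\qquad h=\mathrm{Ind}_{\mathcal C},$$ with optimal value $L^*$, and assume that it has a KKT point, i.e. $x^*\in\mathcal{C}$, $z^*\in\mathbb{R}^m_+$ with $0\in\nabla f(x^*)+\mathcal{N}_{\mathcal C}(x^*)+\sum_i z_i^*\nabla g_i(x^*)$, $g(x^*)\le 0$ and $\langle z^*,g(x^*)\rangle=0$. Let $B_i>0$ satisfy $\|\nabla g_i(x)\|\le B_i$ and $|g_i(x)-g_i(x')|\le B_i\|x-x'\|$ for all $x,x'\in\mathcal{C}$. For $\lambda>0$ and $z\in\mathbb{R}^m_+$ put $$F_\lambda(x,z)=f(x)+\frac{\lambda}{2}\sum_{i=1}^m\Big(\big[g_i(x)+\tfrac{z_i}{\lambda}\big]_+^2-\big(\tfrac{z_i}{\lambda}\big)^2\Big),\quad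 \mathcal{L}_\lambda(x,z)=F_\lambda(x,z)+h(x),\quad L_\Psi(x,z)=\sum_{i=1}^m\big(\lambda B_i^2+L_{g_i}[\lambda g_i(x)+z_i]_+\big)$$ (the parameter $\lambda$ being understood in $L_\Psi$). Assume further that: (a) $\mathcal{C}$ is $(\nu,q)$-uniformly convex for some $\nu>0$, $q\ge 2$, i.e. $tx+(1-t)y+t(1-t)\nu\|x-y\|^q w\in\mathcal{C}$ for all $x,y\in\mathcal{C}$, $t\in[0,1]$ and $w\in\mathbb{R}^n$ with $\|w\|=1$ (strongly convex when $q=2$); (b) for some $\epsilon>0$, $\inf\|\nabla f(x)+\sum_i z_i\nabla g_i(x)\|>0$, where the infimum is over all $x\in\mathcal{C}$ and $z\in\mathbb{R}^m_+$ such that, for every $i$, $g_i(x)\le\epsilon$, and $z_i=0$ whenever $g_i(x)<-\epsilon$. Let $x^0\in\mathcal{C}$, $z^0\in\mathbb{R}^m_+$, and for $k\ge 0$ let $$v^k\in\operatorname*{Arg\,min}_{v\in\mathcal{C}}\langle\nabla_xF_{\lambda_k}(x^k,z^k),v\rangle,\quad x^{k+1}=x^k+\alpha_k(v^k-x^k),\quad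 z^{k+1}=z^k+\sigma_k\max\{-z^k/\lambda_k,\,g(x^{k+1})\}$$ (maximum componentwise), where: $\{\lambda_k\}$ is positive and strictly increasing, $\lambda_k=\Theta(k^\tau)$ and $\lambda_{k+1}-\lambda_k=\mathcal{O}(k^{-(1-\tau)})$ for some $\tau\in(0,1)$; $0<\sigma_k\le\lambda_k$ and $\sigma_k=\Theta(k^{-(1+\gamma)})$ for some $\gamma>0$; and $\alpha_k$ is the short stepsize, i.e., with $G_k=\langle\nabla_xF_{\lambda_k}(x^k,z^k),x^k-v^k\rangle$, $\alpha_k=0$ if $G_k=\|v^k-x^k\|=0$ and otherwise $$\alpha_k=\min\Big\{1,\ \frac{G_k}{(L_\Psi(x^k,z^k)+L_f)\|v^k-x^k\|^2}\Big\}\qquad(\text{with }\lambda=\lambda_k\text{ in }L_\Psi).$$ Set $T_k=[\mathcal{L}_{\lambda_k}(x^k,z^k)-L^*]_+$ and $\mu=1-2/q\in[0,1)$. Then $x^k\in\mathcal{C}$ for all $k$, and as $k\to\infty$ $$T_k=\mathcal{O}\big(\max\{k^{-\frac{1}{1+\mu}},k^{-\frac{2-2\tau}{1+\mu}}\}\big),$$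 $$\max\{|f(x^k)+h(x^k)-L^*|,\ \|[g(x^k)]_+\|\}=\mathcal{O}\big(\max\{k^{-\frac{1}{1+\mu}},k^{-\frac{2-2\tau}{1+\mu}},k^{-\tau}\}\big).$$ In particular, if $q=2$ (strongly convex $\mathcal{C}$) and $\tau=2/3$, the last quantity is $\mathcal{O}(k^{-2/3})$. -/

import Mathlib

open Filter Asymptotics
open scoped Gradient

/-- `ℝᵈ` with the Euclidean inner product and norm. -/
abbrev E (d : ℕ) : Type := EuclideanSpace ℝ (Fin d)

namespace CGAL

noncomputable section

/-- `(ν, q)`-uniform convexity of a convex set in `ℝⁿ` (`q = 2` is strong convexity). -/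
structure UniformlyConvexSet {n : ℕ} (ν q : ℝ) (C : Set (E n)) : Prop where
  q_ge : 2 ≤ q
  nu_pos : 0 < ν
  convex : Convex ℝ C
  mem : ∀ x ∈ C, ∀ y ∈ C, ∀ t : ℝ, 0 ≤ t → t ≤ 1 → ∀ w : E n, ‖w‖ = 1 →
    t • x + (1 - t) • y + (t * (1 - t) * ν * ‖x - y‖ ^ q) • w ∈ C

/-- The normal cone `∂ Ind_C (x)` of `C` at `x`; it is empty for `x ∉ C`. -/
def normalCone {n : ℕ} (C : Set (E n)) (x : E n) : Set (E n) :=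
  {v | x ∈ C ∧ ∀ y ∈ C, inner ℝ v (y - x) ≤ 0}

/-- Minimizers over `C` of the linear functional `v ↦ ⟨u, v⟩`, that is, minimizers over `ℝⁿ` of
`v ↦ ⟨u, v⟩ + Ind_C (v)` (linear minimization oracle). -/
def lmo {n : ℕ} (C : Set (E n)) (u : E n) : Set (E n) :=
  {v | v ∈ C ∧ ∀ y ∈ C, inner ℝ u v ≤ inner ℝ u y}

/-- The feasible set of `min f(x) + Ind_C(x)` subject to `g(x) ≤ 0`. -/
def feasible {n m : ℕ} (g : Fin m → E n → ℝ) (C : Set (E n)) : Set (E n) :=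
  {x | x ∈ C ∧ ∀ i, g i x ≤ 0}

/-- The optimal value `L*` of `min f(x) + Ind_C(x)` subject to `g(x) ≤ 0`. -/
def optVal {n m : ℕ} (f : E n → ℝ) (g : Fin m → E n → ℝ) (C : Set (E n)) : ℝ :=
  sInf (f '' feasible g C)

/-- `(x, z)` is a KKT point of `min f(x) + Ind_C(x)` subject to `g(x) ≤ 0`. -/
structure IsKKT {n m : ℕ} (f : E n → ℝ) (g : Fin m → E n → ℝ) (C : Set (E n))
    (x : E n) (z : E m) : Prop where
  stationary : ∃ w ∈ normalCone C x, ∇ f x + w + ∑ i, z i • ∇ (g i) x = 0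
  primal : ∀ i, g i x ≤ 0
  dual : ∀ i, 0 ≤ z i
  compl : ∑ i, z i * g i x = 0

/-- The standing assumptions on `f`, `g` and `h = Ind_C`, with Lipschitz moduli `Lf` and `Lg i`
of the gradients. -/
structure ProblemAssumption {n m : ℕ} (f : E n → ℝ) (g : Fin m → E n → ℝ) (C : Set (E n))
    (Lf : ℝ) (Lg : Fin m → ℝ) : Prop where
  f_convex : ConvexOn ℝ Set.univ f
  f_diff : Differentiable ℝ f
  Lf_pos : 0 < Lf
  f_lip : ∀ x y, ‖∇ f x - ∇ f y‖ ≤ Lf * ‖x - y‖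
  C_compact : IsCompact C
  C_convex : Convex ℝ C
  g_convex : ∀ i, ConvexOn ℝ Set.univ (g i)
  g_diff : ∀ i, Differentiable ℝ (g i)
  Lg_pos : ∀ i, 0 < Lg i
  g_lip : ∀ i, ∀ x ∈ C, ∀ y ∈ C, ‖∇ (g i) x - ∇ (g i) y‖ ≤ Lg i * ‖x - y‖
  kkt : ∃ x z, IsKKT f g C x z

/-- `B i > 0` bounds the gradient of `g i` on `C` and is a Lipschitz constant of `g i` on `C`. -/
structure GradBound {n m : ℕ} (g : Fin m → E n → ℝ) (C : Set (E n)) (B : Fin m → ℝ) : Prop where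
  pos : ∀ i, 0 < B i
  grad_le : ∀ i, ∀ x ∈ C, ‖∇ (g i) x‖ ≤ B i
  lip : ∀ i, ∀ x ∈ C, ∀ y ∈ C, |g i x - g i y| ≤ B i * ‖x - y‖

/-- The set `𝒜_ε`. -/
def setA {n m : ℕ} (g : Fin m → E n → ℝ) (ε : ℝ) : Set (E n × E m) :=
  {p | (∀ i, g i p.1 ≤ ε) ∧ (∀ i, 0 ≤ p.2 i) ∧ ∀ i, g i p.1 < -ε → p.2 i = 0}

/-- For some `ε > 0`, the norm of the gradient of the Lagrangian `f + ∑ zᵢ gᵢ` has a positive lower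
bound (equivalently, a positive infimum) over `(x, z) ∈ 𝒜_ε` with `x ∈ C`. -/
def LagrangianGradBoundedAway {n m : ℕ} (f : E n → ℝ) (g : Fin m → E n → ℝ)
    (C : Set (E n)) : Prop :=
  ∃ ε : ℝ, 0 < ε ∧ ∃ ζ : ℝ, 0 < ζ ∧ ∀ (x : E n) (z : E m), (x, z) ∈ setA g ε → x ∈ C →
    ζ ≤ ‖∇ f x + ∑ i, z i • ∇ (g i) x‖

/-- `Ψ_l(x, z) = (l / 2) ∑ᵢ ([gᵢ(x) + zᵢ / l]₊² - (zᵢ / l)²)`. -/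
def Psi {n m : ℕ} (g : Fin m → E n → ℝ) (l : ℝ) (x : E n) (z : E m) : ℝ :=
  l / 2 * ∑ i, ((max (g i x + z i / l) 0) ^ 2 - (z i / l) ^ 2)

/-- `F_l(x, z) = f(x) + Ψ_l(x, z)`. For `x ∈ C` this is also the value of the augmented Lagrangian
`𝓛_l(x, z) = f(x) + Ψ_l(x, z) + Ind_C(x)`. -/
def F {n m : ℕ} (f : E n → ℝ) (g : Fin m → E n → ℝ) (l : ℝ) (x : E n) (z : E m) : ℝ :=
  f x + Psi g l x z

/-- `∇ₓ F_l(x, z)`. -/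
def gradF {n m : ℕ} (f : E n → ℝ) (g : Fin m → E n → ℝ) (l : ℝ) (x : E n) (z : E m) : E n :=
  ∇ (fun y => F f g l y z) x

/-- The gap `⟨∇ₓ F_l(x, z), x - v⟩`, for `x ∈ C` and `v` a minimizer of `⟨∇ₓ F_l(x, z), ·⟩`
over `C`. -/
def gap {n m : ℕ} (f : E n → ℝ) (g : Fin m → E n → ℝ) (l : ℝ) (x : E n) (z : E m) (v : E n) : ℝ :=
  inner ℝ (gradF f g l x z) (x - v)

/-- `L_Ψ(x, z) = ∑ᵢ (l Bᵢ² + Lgᵢ [l gᵢ(x) + zᵢ]₊)`. -/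
def LPsi {n m : ℕ} (g : Fin m → E n → ℝ) (Lg B : Fin m → ℝ) (l : ℝ) (x : E n) (z : E m) : ℝ :=
  ∑ i, (l * B i ^ 2 + Lg i * max (l * g i x + z i) 0)

open Classical in
/-- The short stepsize. -/
def shortStep {n m : ℕ} (f : E n → ℝ) (g : Fin m → E n → ℝ) (Lf : ℝ) (Lg B : Fin m → ℝ)
    (l : ℝ) (x : E n) (z : E m) (v : E n) : ℝ :=
  if gap f g l x z v = 0 ∧ ‖v - x‖ = 0 then 0
  else min 1 (gap f g l x z v / ((LPsi g Lg B l x z + Lf) * ‖v - x‖ ^ 2))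

/-- `x, z, v` are generated by the single-loop conditional-gradient augmented-Lagrangian method
with stepsizes `α`, penalty parameters `lam` and dual stepsizes `σ`. -/
structure IsGenerated {n m : ℕ} (f : E n → ℝ) (g : Fin m → E n → ℝ) (C : Set (E n))
    (α lam σ : ℕ → ℝ) (x : ℕ → E n) (z : ℕ → E m) (v : ℕ → E n) : Prop where
  x_zero : x 0 ∈ C
  z_zero : ∀ i, 0 ≤ z 0 i
  alpha_mem : ∀ k, α k ∈ Set.Icc (0 : ℝ) 1
  lam_pos : ∀ k, 0 < lam k
  lam_mono : StrictMono lam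
  lam_tendsto : Tendsto lam atTop atTop
  sigma_pos : ∀ k, 0 < σ k
  sigma_summable : Summable σ
  sigma_le : ∀ k, σ k ≤ lam k
  v_mem : ∀ k, v k ∈ lmo C (gradF f g (lam k) (x k) (z k))
  x_succ : ∀ k, x (k + 1) = x k + α k • (v k - x k)
  z_succ : ∀ k i, z (k + 1) i = z k i + σ k * max (-(z k i / lam k)) (g i (x (k + 1)))

/-- The parameter choice for the short stepsize: `lam k = Θ(k ^ τ)`,
`lam (k+1) - lam k = O(k ^ (-(1 - τ)))`, `σ k = Θ(k ^ (-(1 + γ)))` for some `γ > 0`, and `α k` is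
the short stepsize. -/
structure ShortStepParams {n m : ℕ} (f : E n → ℝ) (g : Fin m → E n → ℝ) (Lf : ℝ)
    (Lg B : Fin m → ℝ) (τ : ℝ) (α lam σ : ℕ → ℝ)
    (x : ℕ → E n) (z : ℕ → E m) (v : ℕ → E n) : Prop where
  tau_mem : τ ∈ Set.Ioo (0 : ℝ) 1
  lam_theta : lam =Θ[atTop] fun k : ℕ => (k : ℝ) ^ τ
  lam_diff : (fun k : ℕ => lam (k + 1) - lam k) =O[atTop] fun k : ℕ => (k : ℝ) ^ (-(1 - τ))
  alpha_eq : ∀ k, α k = shortStep f g Lf Lg B (lam k) (x k) (z k) (v k)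
  sigma_theta : ∃ γ : ℝ, 0 < γ ∧ σ =Θ[atTop] fun k : ℕ => (k : ℝ) ^ (-(1 + γ))

/-- `T_l(x, z) = [𝓛_l(x, z) - L*]₊` for `x ∈ C`. -/
def T {n m : ℕ} (f : E n → ℝ) (g : Fin m → E n → ℝ) (C : Set (E n)) (l : ℝ)
    (x : E n) (z : E m) : ℝ :=
  max (F f g l x z - optVal f g C) 0

/-- The infeasibility `‖[g(x)]₊‖` (Euclidean norm). -/
def infeas {n m : ℕ} (g : Fin m → E n → ℝ) (x : E n) : ℝ :=
  ‖(WithLp.toLp 2 fun i => max (g i x) 0 : E m)‖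

end

end CGAL

/-! Everything rests on one scalar recursion for `T_k`. In the primal step, convexity at a KKT point
bounds `T_k` by the Frank-Wolfe gap `G` (`IsKKT.sub_optVal_le_gap`), and the curvature along the
step is `O(λ_k)`. If `‖v - x‖² ≤ A G^(1-μ)`, the short step removes at least `min(1/2, T_k^μ / (2 c
λ_k A)) T_k`. In the dual step, `Ψ` is jointly concave in `(z, λ)`, with supergradient `u` in `z`
and `‖u‖²/2` in `λ`, where `u = max{-z/λ, g(x)}`. Changing `z` and `λ` thus costs at most `(σ_k +
(λ_{k+1} - λ_k)/2) ‖u‖²`. Weak duality gives `‖u‖² ≤ 4T/λ + 4D/λ²`, so this cost is a relative error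
`O(1/k)` plus an absolute error `O(k^(-(1+τ)))`.

Uniform convexity gives `G ≥ (ν/2) ‖∇F‖ ‖v - x‖^q`, hence the required bound with `1 - μ = 2/q`,
provided `‖∇F‖` stays away from `0`. Assumption (b) yields this only once the iterates are nearly
feasible, so the recursion is used twice. The first use has exponent `1` and only the diameter of
`C`; it gives `T_k/λ_k → 0`, hence `u → 0` and eventual membership in `setA`
(`IsGenerated.eventually_mem_setA`). The second use has the true `μ` and gives the rate of `T_k`
(`IsGenerated.T_isBigO`). Objective error and infeasibility are then `O(T_k + 1/λ_k)`. -/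

namespace CGAL

/-! ### Gradient inequalities on segments -/

section Gradient

variable {V : Type*} [NormedAddCommGroup V] [InnerProductSpace ℝ V] [CompleteSpace V]

theorem hasDerivAt_comp_line {f : V → ℝ} (hf : Differentiable ℝ f) (x d : V) (t : ℝ) :
    HasDerivAt (fun s : ℝ => f (x + s • d)) (inner ℝ (∇ f (x + t • d)) d) t := by
  have h1 : HasDerivAt (fun s : ℝ => x + s • d) d t := by
    simpa using ((hasDerivAt_id t).smul_const d).const_add x
  exact (hf (x + t • d)).hasGradientAt.hasFDerivAt.comp_hasDerivAt t h1

theorem inner_gradient_le_sub {f : V → ℝ} (hc : ConvexOn ℝ Set.univ f) (hf : Differentiable ℝ f)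
    (x y : V) : inner ℝ (∇ f x) (y - x) ≤ f y - f x := by
  have hd := hasDerivAt_comp_line hf x (y - x) 0
  have hcv : ConvexOn ℝ Set.univ (fun s : ℝ => f (x + s • (y - x))) := by
    have := hc.comp_affineMap (AffineMap.lineMap x y : ℝ →ᵃ[ℝ] V)
    refine this.congr fun s _ => ?_
    simp [AffineMap.lineMap_apply, add_comm]
  have h := hcv.le_slope_of_hasDerivAt (Set.mem_univ 0) (Set.mem_univ 1) one_pos hd
  simpa [slope_def_field] using h

/-- The descent lemma for a function whose gradient is Lipschitz on a convex set. -/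
theorem le_add_inner_gradient_add_sq {f : V → ℝ} {C : Set V} {K : ℝ} (hC : Convex ℝ C)
    (hf : Differentiable ℝ f)
    (hK : ∀ x ∈ C, ∀ y ∈ C, ‖∇ f x - ∇ f y‖ ≤ K * ‖x - y‖) {x y : V} (hx : x ∈ C) (hy : y ∈ C) :
    f y ≤ f x + inner ℝ (∇ f x) (y - x) + K / 2 * ‖y - x‖ ^ 2 := by
  set d := y - x with hd
  have hder (t : ℝ) : HasDerivAt
      (fun s : ℝ => f (x + s • d) - (s * inner ℝ (∇ f x) d + s ^ 2 * (K / 2 * ‖d‖ ^ 2)))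
      (inner ℝ (∇ f (x + t • d)) d - (inner ℝ (∇ f x) d + 2 * t * (K / 2 * ‖d‖ ^ 2))) t := by
    have h1 := (hasDerivAt_id t).mul_const (inner ℝ (∇ f x) d)
    have h2 := ((hasDerivAt_id t).pow 2).mul_const (K / 2 * ‖d‖ ^ 2)
    refine (hasDerivAt_comp_line hf x d t).sub ((h1.add h2).congr_deriv ?_)
    simp
  have hanti := antitoneOn_of_deriv_nonpos (convex_Icc (0 : ℝ) 1)
    (fun t _ => (hder t).continuousAt.continuousWithinAt)
    (fun t _ => (hder t).differentiableAt.differentiableWithinAt)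
    (fun t ht => by
      rw [interior_Icc] at ht
      rw [(hder t).deriv]
      have hmem : x + t • d ∈ C := hC.add_smul_sub_mem hx hy ⟨ht.1.le, ht.2.le⟩
      have h1 : inner ℝ (∇ f (x + t • d) - ∇ f x) d ≤ K * (t * ‖d‖) * ‖d‖ := by
        refine (real_inner_le_norm _ _).trans ?_
        gcongr
        refine (hK _ hmem _ hx).trans_eq ?_
        rw [add_sub_cancel_left, norm_smul, Real.norm_of_nonneg ht.1.le]
      rw [inner_sub_left] at h1
      linarith)
  have h := hanti (Set.left_mem_Icc.2 zero_le_one) (Set.right_mem_Icc.2 zero_le_one) zero_le_one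
  simp only [one_smul, one_mul, zero_smul, add_zero, zero_mul, hd, add_sub_cancel] at h
  simp only [hd]
  linarith

end Gradient

/-! ### Smoothness and concavity of the augmented Lagrangian -/

theorem hasDerivAt_max_zero_sq (s : ℝ) :
    HasDerivAt (fun s : ℝ => (max s 0) ^ 2) (2 * max s 0) s := by
  rcases lt_trichotomy s 0 with h | rfl | h
  · have : (fun s : ℝ => (max s 0) ^ 2) =ᶠ[nhds s] fun _ => 0 := by
      filter_upwards [Iio_mem_nhds h] with t ht
      simp [max_eq_right (Set.mem_Iio.1 ht).le]
    rw [max_eq_right h.le, mul_zero]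
    exact (hasDerivAt_const s (0 : ℝ)).congr_of_eventuallyEq this
  · rw [max_self, mul_zero, hasDerivAt_iff_isLittleO]
    simp only [max_self, sub_zero, smul_zero, ne_eq, OfNat.ofNat_ne_zero, not_false_eq_true,
      zero_pow]
    refine IsBigO.trans_isLittleO (g := fun s : ℝ => s ^ 2) (IsBigO.of_bound 1 ?_)
      (isLittleO_pow_id (by norm_num))
    refine Eventually.of_forall fun t => ?_
    rw [norm_pow, norm_pow, one_mul]
    gcongr
    rcases le_total t 0 with h | h
    · simp [max_eq_right h]
    · simp [max_eq_left h]
  · have : (fun s : ℝ => (max s 0) ^ 2) =ᶠ[nhds s] fun t => t ^ 2 := by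
      filter_upwards [Ioi_mem_nhds h] with t ht
      simp [max_eq_left (Set.mem_Ioi.1 ht).le]
    rw [max_eq_left h.le]
    refine HasDerivAt.congr_of_eventuallyEq ?_ this
    exact ((hasDerivAt_id s).pow 2).congr_deriv (by simp)

theorem sq_max_le (s t : ℝ) :
    (max t 0) ^ 2 ≤ (max s 0) ^ 2 + 2 * max s 0 * (t - s) + (t - s) ^ 2 := by
  rcases le_total s 0 with hs | hs <;> rcases le_total t 0 with ht | ht <;>
    simp only [max_eq_left, max_eq_right, hs, ht] <;> nlinarith

variable {n m : ℕ} {f : E n → ℝ} {g : Fin m → E n → ℝ} {C : Set (E n)} {Lf : ℝ}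
  {Lg B : Fin m → ℝ} {l : ℝ}

/-- The updated multipliers `[l gᵢ(x) + zᵢ]₊`. -/
noncomputable def mult (g : Fin m → E n → ℝ) (l : ℝ) (x : E n) (z : E m) (i : Fin m) : ℝ :=
  max (l * g i x + z i) 0

theorem mult_nonneg (x : E n) (z : E m) (i : Fin m) : 0 ≤ mult g l x z i := le_max_right _ _

theorem max_add_div_eq (hl : 0 < l) (a b : ℝ) : max (a + b / l) 0 = max (l * a + b) 0 / l := by
  rw [← max_div_div_right hl.le, zero_div, add_div, mul_div_cancel_left₀ _ hl.ne']

theorem Psi_eq (hl : 0 < l) (x : E n) (z : E m) :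
    Psi g l x z = ∑ i, (mult g l x z i ^ 2 - z i ^ 2) / (2 * l) := by
  rw [Psi, Finset.mul_sum]
  refine Finset.sum_congr rfl fun i _ => ?_
  rw [max_add_div_eq hl, mult]
  field_simp

theorem gradF_eq (hf : Differentiable ℝ f) (hg : ∀ i, Differentiable ℝ (g i)) (hl : 0 < l)
    (x : E n) (z : E m) :
    gradF f g l x z = ∇ f x + ∑ i, mult g l x z i • ∇ (g i) x := by
  refine HasGradientAt.gradient ?_
  rw [hasGradientAt_iff_hasFDerivAt]
  have hi (i : Fin m) : HasFDerivAt
      (fun y => l / 2 * ((max (g i y + z i / l) 0) ^ 2 - (z i / l) ^ 2))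
      (mult g l x z i • (InnerProductSpace.toDual ℝ (E n)) (∇ (g i) x)) x := by
    have h1 := ((hg i x).hasGradientAt.hasFDerivAt).add_const (z i / l)
    have h2 := (hasDerivAt_max_zero_sq (g i x + z i / l)).comp_hasFDerivAt x h1
    refine ((h2.sub_const ((z i / l) ^ 2)).const_mul (l / 2)).congr_fderiv ?_
    rw [smul_smul, max_add_div_eq hl, mult]
    congr 1
    field_simp
  have h := (hf x).hasGradientAt.hasFDerivAt.add (HasFDerivAt.fun_sum (u := Finset.univ)
    fun i _ => hi i)
  have e : (fun y => F f g l y z) = fun y => f y +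
      ∑ i, l / 2 * ((max (g i y + z i / l) 0) ^ 2 - (z i / l) ^ 2) := by
    funext y
    rw [F, Psi, Finset.mul_sum]
  rw [e]
  refine h.congr_fderiv ?_
  simp [map_add, map_sum]

theorem inner_gradF (hf : Differentiable ℝ f) (hg : ∀ i, Differentiable ℝ (g i)) (hl : 0 < l)
    (x : E n) (z : E m) (d : E n) :
    inner ℝ (gradF f g l x z) d =
      inner ℝ (∇ f x) d + ∑ i, mult g l x z i * inner ℝ (∇ (g i) x) d := by
  simp [gradF_eq hf hg hl, inner_add_left, sum_inner, real_inner_smul_left]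

theorem LPsi_nonneg (hLg : ∀ i, 0 < Lg i) (hl : 0 < l) (x : E n) (z : E m) :
    0 ≤ LPsi g Lg B l x z :=
  Finset.sum_nonneg fun i _ =>
    add_nonneg (by positivity) (mul_nonneg (hLg i).le (le_max_right _ _))

/-- The two terms of `LPsi` have separate sources: `l Bᵢ²` is the curvature of the squared positive
part, through the Lipschitz constant of `gᵢ`, and `Lgᵢ [l gᵢ + zᵢ]₊` is the curvature of `gᵢ`
weighted by its multiplier. -/
theorem F_descent (hprob : ProblemAssumption f g C Lf Lg) (hB : GradBound g C B) (hl : 0 < l)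
    {x y : E n} (hx : x ∈ C) (hy : y ∈ C) (z : E m) :
    F f g l y z ≤ F f g l x z + inner ℝ (gradF f g l x z) (y - x)
      + (LPsi g Lg B l x z + Lf) / 2 * ‖y - x‖ ^ 2 := by
  have hf := le_add_inner_gradient_add_sq convex_univ hprob.f_diff
    (fun a _ b _ => hprob.f_lip a b) (Set.mem_univ x) (Set.mem_univ y)
  have hg (i : Fin m) : (mult g l y z i ^ 2 - z i ^ 2) / (2 * l) ≤
      (mult g l x z i ^ 2 - z i ^ 2) / (2 * l) + mult g l x z i * inner ℝ (∇ (g i) x) (y - x) +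
        (l * B i ^ 2 + Lg i * mult g l x z i) / 2 * ‖y - x‖ ^ 2 := by
    have h1 := le_add_inner_gradient_add_sq hprob.C_convex (hprob.g_diff i) (hprob.g_lip i) hx hy
    have h2 : (g i y - g i x) ^ 2 ≤ (B i * ‖y - x‖) ^ 2 :=
      sq_le_sq' (by linarith [neg_abs_le (g i y - g i x), hB.lip i y hy x hx])
        ((le_abs_self _).trans (hB.lip i y hy x hx))
    have h3 := sq_max_le (l * g i x + z i) (l * g i y + z i)
    change mult g l y z i ^ 2 ≤ mult g l x z i ^ 2 + 2 * mult g l x z i * _ + _ at h3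
    have hp := mult_nonneg (g := g) (l := l) x z i
    have h4 := mul_le_mul_of_nonneg_left h1 hp
    have e : mult g l y z i ^ 2 ≤ mult g l x z i ^ 2 + 2 * l * (mult g l x z i * (g i y - g i x))
        + l ^ 2 * (B i * ‖y - x‖) ^ 2 := by
      nlinarith [mul_le_mul_of_nonneg_left h2 (sq_nonneg l)]
    calc (mult g l y z i ^ 2 - z i ^ 2) / (2 * l)
        ≤ (mult g l x z i ^ 2 + 2 * l * (mult g l x z i * (g i y - g i x))
          + l ^ 2 * (B i * ‖y - x‖) ^ 2 - z i ^ 2) / (2 * l) := by gcongr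
      _ = (mult g l x z i ^ 2 - z i ^ 2) / (2 * l) + mult g l x z i * (g i y - g i x)
          + l * (B i * ‖y - x‖) ^ 2 / 2 := by field_simp; ring
      _ ≤ _ := by nlinarith
  have hsum := Finset.sum_le_sum fun i (_ : i ∈ Finset.univ) => hg i
  rw [Finset.sum_add_distrib, Finset.sum_add_distrib, ← Finset.sum_mul,
    ← Finset.sum_div (f := fun i => l * B i ^ 2 + Lg i * mult g l x z i)] at hsum
  rw [F, F, Psi_eq hl, Psi_eq hl, inner_gradF hprob.f_diff hprob.g_diff hl]
  change _ ≤ _ + (∑ i, (l * B i ^ 2 + Lg i * mult g l x z i) + Lf) / 2 * ‖y - x‖ ^ 2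
  linarith

/-- Joint concavity of `(z, l) ↦ Ψ_l(x, z)`, as a supergradient inequality. -/
theorem Psi_le_add (hl : 0 < l) {l' : ℝ} (hl' : 0 < l') (x : E n) (z z' : E m) :
    Psi g l' x z' ≤ Psi g l x z + ∑ i, ((mult g l x z i - z i) / l * (z' i - z i)
      + ((mult g l x z i - z i) / l) ^ 2 / 2 * (l' - l)) := by
  rw [Psi_eq hl, Psi_eq hl', ← Finset.sum_add_distrib]
  refine Finset.sum_le_sum fun i _ => ?_
  -- `(p² - z²) / (2l) = p g(x) - (p - z)² / (2l)` at the maximizer `p` of the right side over `p ≥ 0`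
  have key (l : ℝ) (hl : 0 < l) (z : E m) : (mult g l x z i ^ 2 - z i ^ 2) / (2 * l) =
      mult g l x z i * g i x - (mult g l x z i - z i) ^ 2 / (2 * l) := by
    unfold mult
    rcases le_total (l * g i x + z i) 0 with h | h
    · rw [max_eq_right h]; ring
    · rw [max_eq_left h]; field_simp; ring
  have hp' := mult_nonneg (g := g) (l := l') x z' i
  -- First-order optimality of `p` over the half-line `p ≥ 0`, tested at the competitor `p'`.
  have hopt : (mult g l' x z' i - mult g l x z i) * (g i x - (mult g l x z i - z i) / l) ≤ 0 := by
    have hx : g i x = l * g i x / l := by field_simp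
    unfold mult at hp' ⊢
    rcases le_total (l * g i x + z i) 0 with h | h
    · rw [max_eq_right h, sub_zero]
      refine mul_nonpos_of_nonneg_of_nonpos hp' ?_
      rw [hx, ← sub_div]
      exact div_nonpos_of_nonpos_of_nonneg (by linarith) hl.le
    · rw [max_eq_left h, add_sub_cancel_right, ← hx, sub_self, mul_zero]
  rw [key l hl, key l' hl']
  generalize mult g l x z i = p at *
  generalize mult g l' x z' i = p' at *
  -- In the variables `u`, `u'` the denominators cancel, and the slack left over is `l' (u' - u)² /
  -- 2`.
  obtain ⟨u, rfl⟩ : ∃ u, p = z i + l * u := ⟨(p - z i) / l, by field_simp; ring⟩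
  obtain ⟨u', rfl⟩ : ∃ u', p' = z' i + l' * u' := ⟨(p' - z' i) / l', by field_simp; ring⟩
  have e1 : (z i + l * u - z i) / l = u := by field_simp; ring
  have e2 : (z i + l * u - z i) ^ 2 / (2 * l) = l * u ^ 2 / 2 := by field_simp; ring
  have e3 : (z' i + l' * u' - z' i) ^ 2 / (2 * l') = l' * u' ^ 2 / 2 := by field_simp; ring
  rw [e1] at hopt ⊢
  rw [e2, e3]
  nlinarith [mul_nonneg hl'.le (sq_nonneg (u' - u))]

end CGAL

/-! ### KKT points and the effect of one iteration -/

namespace CGAL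

variable {n m : ℕ} {f : E n → ℝ} {g : Fin m → E n → ℝ} {C : Set (E n)} {Lf : ℝ}
  {Lg B : Fin m → ℝ} {l : ℝ} {xs : E n} {zs : E m}

theorem IsKKT.mem (hk : IsKKT f g C xs zs) : xs ∈ C := by
  obtain ⟨w, hw, -⟩ := hk.stationary
  exact hw.1

theorem IsKKT.le_lagrangian (hprob : ProblemAssumption f g C Lf Lg) (hk : IsKKT f g C xs zs)
    {x : E n} (hx : x ∈ C) : f xs ≤ f x + ∑ i, zs i * g i x := by
  obtain ⟨w, hw, h0⟩ := hk.stationary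
  have h1 := inner_gradient_le_sub hprob.f_convex hprob.f_diff xs x
  have h2 := Finset.sum_le_sum fun i (_ : i ∈ Finset.univ) => mul_le_mul_of_nonneg_left
    (inner_gradient_le_sub (hprob.g_convex i) (hprob.g_diff i) xs x) (hk.dual i)
  have h3 := congrArg (fun u => inner ℝ u (x - xs)) h0
  simp only [inner_add_left, sum_inner, real_inner_smul_left, inner_zero_left] at h3
  have h4 := hw.2 x hx
  simp only [mul_sub (zs _) (g _ x), Finset.sum_sub_distrib, hk.compl] at h2
  linarith

theorem IsKKT.optVal_eq (hprob : ProblemAssumption f g C Lf Lg) (hk : IsKKT f g C xs zs) :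
    optVal f g C = f xs := by
  refine IsLeast.csInf_eq ⟨⟨xs, ⟨hk.mem, hk.primal⟩, rfl⟩, ?_⟩
  rintro _ ⟨x, hx, rfl⟩
  have h := hk.le_lagrangian hprob hx.1
  have : ∑ i, zs i * g i x ≤ 0 :=
    Finset.sum_nonpos fun i _ => mul_nonpos_of_nonneg_of_nonpos (hk.dual i) (hx.2 i)
  linarith

/-- The multiplier update is a proximal step on the dual: comparing it with the dual solution `zs`
and applying weak duality shows that it can move away from `zs` only as far as the Lagrangian
exceeds `L*`. -/
theorem IsKKT.sum_sq_mult_sub_le (hprob : ProblemAssumption f g C Lf Lg)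
    (hk : IsKKT f g C xs zs) (hl : 0 < l) {x : E n} (hx : x ∈ C) (z : E m) :
    ∑ i, (mult g l x z i - zs i) ^ 2 ≤
      2 * l * (F f g l x z - optVal f g C) + ∑ i, (z i - zs i) ^ 2 := by
  have h := hk.le_lagrangian hprob hx
  rw [F, Psi_eq hl, hk.optVal_eq hprob, add_sub_right_comm, mul_add, Finset.mul_sum, add_assoc,
    ← Finset.sum_add_distrib]
  have h2 : ∑ i, ((mult g l x z i - zs i) ^ 2 - (2 * l * ((mult g l x z i ^ 2 - z i ^ 2) / (2 * l))
      + (z i - zs i) ^ 2)) ≤ ∑ i, -(2 * l) * (zs i * g i x) := by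
    refine Finset.sum_le_sum fun i _ => ?_
    rw [mul_div_cancel₀ _ (by positivity)]
    have h3 : l * g i x + z i ≤ mult g l x z i := le_max_left _ _
    nlinarith [mul_le_mul_of_nonneg_left h3 (hk.dual i)]
  rw [Finset.sum_sub_distrib, ← Finset.mul_sum] at h2
  nlinarith

theorem IsKKT.sub_optVal_le_gap (hprob : ProblemAssumption f g C Lf Lg)
    (hk : IsKKT f g C xs zs) (hl : 0 < l) (x : E n) (z : E m) {v : E n}
    (hv : v ∈ lmo C (gradF f g l x z)) : F f g l x z - optVal f g C ≤ gap f g l x z v := by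
  have h1 := hv.2 xs hk.mem
  have h2 := inner_gradF hprob.f_diff hprob.g_diff hl x z (xs - x)
  have h3 := inner_gradient_le_sub hprob.f_convex hprob.f_diff x xs
  have h4 : ∑ i, mult g l x z i * inner ℝ (∇ (g i) x) (xs - x) ≤
      ∑ i, -((mult g l x z i ^ 2 - z i ^ 2) / (2 * l)) := by
    refine Finset.sum_le_sum fun i _ => ?_
    have hp := mult_nonneg (g := g) (l := l) x z i
    have h5 := mul_le_mul_of_nonneg_left
      (inner_gradient_le_sub (hprob.g_convex i) (hprob.g_diff i) x xs) hp
    have h6 : mult g l x z i * g i xs ≤ 0 :=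
      mul_nonpos_of_nonneg_of_nonpos hp (hk.primal i)
    -- With `p` the multiplier, the difference of the two sides is `z² / (2l)` when `p = 0` and `l
    -- g² / 2` otherwise.
    have h7 : (mult g l x z i ^ 2 - z i ^ 2) / (2 * l) ≤ mult g l x z i * g i x := by
      rw [div_le_iff₀ (by positivity)]
      unfold mult
      rcases le_total (l * g i x + z i) 0 with h | h
      · rw [max_eq_right h]; nlinarith [sq_nonneg (z i)]
      · rw [max_eq_left h]; nlinarith [sq_nonneg (l * g i x)]
    linarith
  rw [Finset.sum_neg_distrib] at h4
  rw [gap, inner_sub_right, F, Psi_eq hl, hk.optVal_eq hprob]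
  rw [inner_sub_right] at h2
  linarith

theorem UniformlyConvexSet.le_inner_sub {ν q : ℝ} (hC : UniformlyConvexSet ν q C) {u v x : E n}
    (hv : v ∈ lmo C u) (hx : x ∈ C) :
    ν / 2 * ‖u‖ * ‖v - x‖ ^ q ≤ inner ℝ u (x - v) := by
  rcases eq_or_ne u 0 with rfl | hu
  · simp
  have hu' : ‖u‖ ≠ 0 := norm_ne_zero_iff.2 hu
  have hw : ‖-(‖u‖⁻¹ • u)‖ = 1 := by
    rw [norm_neg, norm_smul, norm_inv, norm_norm, inv_mul_cancel₀ hu']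
  -- The midpoint of `v` and `x`, pushed against `u`, stays in `C`. Optimality of `v` against it
  -- loses `ν/4`, which doubles to `ν/2` on clearing the factor `1/2`.
  have h := hv.2 _ (hC.mem v hv.1 x hx (1 / 2) (by norm_num) (by norm_num) _ hw)
  simp only [inner_add_right, real_inner_smul_right, inner_neg_right,
    real_inner_self_eq_norm_sq] at h
  have e : ‖u‖⁻¹ * ‖u‖ ^ 2 = ‖u‖ := by field_simp
  rw [e] at h
  rw [inner_sub_right]
  linarith

theorem F_shortStep_le (hprob : ProblemAssumption f g C Lf Lg) (hB : GradBound g C B)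
    (hl : 0 < l) {x v : E n} (hx : x ∈ C) (z : E m) (hv : v ∈ lmo C (gradF f g l x z))
    {μ A : ℝ} (hA : 0 < A) (hd : ‖v - x‖ ^ 2 ≤ A * gap f g l x z v ^ (1 - μ)) :
    F f g l (x + shortStep f g Lf Lg B l x z v • (v - x)) z ≤ F f g l x z -
      min (1 / 2) (gap f g l x z v ^ μ / (2 * (LPsi g Lg B l x z + Lf) * A)) *
        gap f g l x z v := by
  have hG0 : 0 ≤ gap f g l x z v := by
    have := hv.2 x hx
    rw [gap, inner_sub_right]; linarith
  set G := gap f g l x z v with hG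
  set K := LPsi g Lg B l x z + Lf with hK
  have hKpos : 0 < K := add_pos_of_nonneg_of_pos (LPsi_nonneg hprob.Lg_pos hl x z) hprob.Lf_pos
  rcases hG0.eq_or_lt with hz | hpos
  · have : shortStep f g Lf Lg B l x z v = 0 := by
      simp [shortStep, ← hG, ← hz]
    rw [this, ← hz]; simp
  have hdpos : 0 < ‖v - x‖ := by
    rw [norm_pos_iff]
    intro h0
    rw [hG, gap, ← neg_sub, h0] at hpos
    simp at hpos
  have hstep : shortStep f g Lf Lg B l x z v = min 1 (G / (K * ‖v - x‖ ^ 2)) := by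
    rw [shortStep, if_neg]
    exact fun h => hdpos.ne' h.2
  have hs0 : 0 ≤ min 1 (G / (K * ‖v - x‖ ^ 2)) := le_min zero_le_one (by positivity)
  have hdesc := F_descent hprob hB hl hx
    (hprob.C_convex.add_smul_sub_mem hx hv.1 ⟨hs0, min_le_left _ _⟩) z
  have hin : inner ℝ (gradF f g l x z) (v - x) = -G := by
    rw [hG, gap, ← neg_sub x v, inner_neg_right]
  rw [add_sub_cancel_left, real_inner_smul_right, norm_smul, hin, Real.norm_of_nonneg hs0,
    ← hK] at hdesc
  rw [hstep]
  have hKd : 0 < K * ‖v - x‖ ^ 2 := by positivity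
  -- A full step gains at least `G/2`; otherwise the quadratic model is minimized exactly, with gain
  -- `G² / (2K‖v - x‖²)`, and the hypothesis on `‖v - x‖²` converts this to a power of `G`.
  rcases le_total (K * ‖v - x‖ ^ 2) G with h | h
  · rw [min_eq_left ((one_le_div hKd).2 h)] at hdesc ⊢
    have := mul_le_mul_of_nonneg_right (min_le_left (1 / 2) (G ^ μ / (2 * K * A))) hpos.le
    linarith
  · rw [min_eq_right ((div_le_one hKd).2 h)] at hdesc ⊢
    have h1 := mul_le_mul_of_nonneg_right (min_le_right (1 / 2) (G ^ μ / (2 * K * A))) hpos.le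
    have h2 : G ^ μ / (2 * K * A) * G ≤ G ^ 2 / (2 * K * ‖v - x‖ ^ 2) := by
      have hGG : G ^ (1 - μ) * G ^ μ = G := by
        rw [← Real.rpow_add hpos]; simp
      rw [div_mul_eq_mul_div, div_le_div_iff₀ (by positivity) (by positivity)]
      have hGm : 0 ≤ G ^ μ := by positivity
      calc G ^ μ * G * (2 * K * ‖v - x‖ ^ 2)
          ≤ G ^ μ * G * (2 * K * (A * G ^ (1 - μ))) := by gcongr
        _ = (G ^ (1 - μ) * G ^ μ) * G * (2 * K * A) := by ring
        _ = G ^ 2 * (2 * K * A) := by rw [hGG]; ring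
    have h3 : G / (K * ‖v - x‖ ^ 2) * -G + K / 2 * (G / (K * ‖v - x‖ ^ 2) * ‖v - x‖) ^ 2 =
        -(G ^ 2 / (2 * K * ‖v - x‖ ^ 2)) := by
      field_simp; ring
    linarith

theorem T_nonneg (x : E n) (z : E m) : 0 ≤ T f g C l x z := le_max_right _ _

theorem IsKKT.T_shortStep_le (hprob : ProblemAssumption f g C Lf Lg) (hk : IsKKT f g C xs zs)
    (hB : GradBound g C B)
    (hl : 0 < l) {x v : E n} (hx : x ∈ C) (z : E m) (hv : v ∈ lmo C (gradF f g l x z))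
    {μ A K : ℝ} (hμ : 0 ≤ μ) (hA : 0 < A) (hd : ‖v - x‖ ^ 2 ≤ A * gap f g l x z v ^ (1 - μ))
    (hK : LPsi g Lg B l x z + Lf ≤ K) :
    T f g C l (x + shortStep f g Lf Lg B l x z v • (v - x)) z ≤ T f g C l x z -
      min (1 / 2) (T f g C l x z ^ μ / (2 * K * A)) * T f g C l x z := by
  have hKpos : 0 < LPsi g Lg B l x z + Lf :=
    add_pos_of_nonneg_of_pos (LPsi_nonneg hprob.Lg_pos hl x z) hprob.Lf_pos
  have hG0 : 0 ≤ gap f g l x z v := by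
    have := hv.2 x hx
    rw [gap, inner_sub_right]; linarith
  have hT0 : 0 ≤ T f g C l x z := T_nonneg x z
  have hTG : T f g C l x z ≤ gap f g l x z v := max_le (hk.sub_optVal_le_gap hprob hl x z hv) hG0
  have h1 := F_shortStep_le hprob hB hl hx z hv hA hd
  have h2 : min (1 / 2) (T f g C l x z ^ μ / (2 * K * A)) * T f g C l x z ≤
      min (1 / 2) (gap f g l x z v ^ μ / (2 * (LPsi g Lg B l x z + Lf) * A)) *
        gap f g l x z v := by
    gcongr
  refine max_le ?_ ?_
  · have : F f g l x z - optVal f g C ≤ T f g C l x z := le_max_left _ _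
    linarith
  -- The cap `1/2` keeps the right side nonnegative, so truncation at `0` does no harm.
  · have := mul_le_mul_of_nonneg_right (min_le_left (1 / 2) (T f g C l x z ^ μ / (2 * K * A))) hT0
    linarith

/-- Identifies the supergradient of `Ψ` in `z` with the direction of the dual update. -/
theorem mult_sub_div_eq (hl : 0 < l) (x : E n) (z : E m) (i : Fin m) :
    (mult g l x z i - z i) / l = max (-(z i / l)) (g i x) := by
  rw [mult, max_comm, ← max_sub_sub_right, ← max_div_div_right hl.le, zero_sub, neg_div,
    add_sub_cancel_right, mul_div_cancel_left₀ _ hl.ne']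

theorem IsKKT.sum_sq_mult_sub_self_le (hprob : ProblemAssumption f g C Lf Lg)
    (hk : IsKKT f g C xs zs) (hl : 0 < l) {x : E n} (hx : x ∈ C) {z : E m} {D : ℝ}
    (hD : ∑ i, (z i - zs i) ^ 2 ≤ D) :
    ∑ i, ((mult g l x z i - z i) / l) ^ 2 ≤ 4 * T f g C l x z / l + 4 * D / l ^ 2 := by
  have h1 := hk.sum_sq_mult_sub_le hprob hl hx z
  have h2 : ∑ i, (mult g l x z i - z i) ^ 2 ≤
      2 * (∑ i, (mult g l x z i - zs i) ^ 2 + ∑ i, (z i - zs i) ^ 2) := by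
    rw [← Finset.sum_add_distrib, Finset.mul_sum]
    refine Finset.sum_le_sum fun i _ => ?_
    nlinarith [sq_nonneg (mult g l x z i - zs i + (z i - zs i))]
  have h3 : F f g l x z - optVal f g C ≤ T f g C l x z := le_max_left _ _
  have h4 := mul_le_mul_of_nonneg_left h3 (by positivity : 0 ≤ 2 * l)
  have e : 4 * T f g C l x z / l + 4 * D / l ^ 2 = (4 * l * T f g C l x z + 4 * D) / l ^ 2 := by
    field_simp
  simp only [div_pow]
  rw [← Finset.sum_div, e]
  gcongr
  linarith

theorem IsKKT.T_dual_update_le (hprob : ProblemAssumption f g C Lf Lg)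
    (hk : IsKKT f g C xs zs) (hl : 0 < l) {l' : ℝ} (hl' : l ≤ l') {σ : ℝ} (hσ : 0 ≤ σ)
    {x : E n} (hx : x ∈ C) {z z' : E m} {D : ℝ} (hD : ∑ i, (z i - zs i) ^ 2 ≤ D)
    (hz : ∀ i, z' i = z i + σ * max (-(z i / l)) (g i x)) :
    T f g C l' x z' ≤ T f g C l x z +
      (σ + (l' - l) / 2) * (4 * T f g C l x z / l + 4 * D / l ^ 2) := by
  have hT := T_nonneg (f := f) (g := g) (C := C) (l := l) x z
  have hD0 : 0 ≤ D := (Finset.sum_nonneg fun i _ => sq_nonneg _).trans hD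
  have h1 := Psi_le_add (g := g) hl (hl.trans_le hl') x z z'
  have h2 : ∑ i, ((mult g l x z i - z i) / l * (z' i - z i)
      + ((mult g l x z i - z i) / l) ^ 2 / 2 * (l' - l)) =
      (σ + (l' - l) / 2) * ∑ i, ((mult g l x z i - z i) / l) ^ 2 := by
    rw [Finset.mul_sum]
    refine Finset.sum_congr rfl fun i _ => ?_
    rw [hz i, ← mult_sub_div_eq hl]
    ring
  have hη : 0 ≤ σ + (l' - l) / 2 := by linarith
  have h3 := mul_le_mul_of_nonneg_left (hk.sum_sq_mult_sub_self_le hprob hl hx hD) hη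
  refine max_le ?_ (by positivity)
  have h4 : F f g l x z - optVal f g C ≤ T f g C l x z := le_max_left _ _
  rw [F] at h4 ⊢
  linarith

end CGAL

/-! ### Scalar recursions -/

namespace CGAL

/-- Boundedness of a nonnegative sequence subject to a perturbed contraction whose factor
`1 - c k ^ (-s)`, `s < 1`, is effective as soon as the sequence exceeds `1`. -/
theorem bounded_of_recursion {w : ℕ → ℝ} {A b μ s e : ℝ} (hw : ∀ k, 0 ≤ w k) (hA : 0 ≤ A)
    (hb : 0 < b) (hμ : 0 ≤ μ) (hs0 : 0 ≤ s) (hs : s < 1) (he : s ≤ e)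
    (h : ∀ᶠ k : ℕ in atTop, w (k + 1) ≤
      (1 + A / k) * (w k - min (1 / 2) (b * w k ^ μ * (k : ℝ) ^ (-s)) * w k)
        + A * (k : ℝ) ^ (-e)) :
    ∃ K, ∀ᶠ k in atTop, w k ≤ K := by
  set c := min (1 / 2) b with hc
  have hcpos : 0 < c := lt_min (by norm_num) hb
  have hlim : ∀ᶠ k : ℕ in atTop, A * (k : ℝ) ^ (-(1 - s)) ≤ c / 2 := by
    have h1 := ((tendsto_rpow_neg_atTop (sub_pos.2 hs)).comp
      tendsto_natCast_atTop_atTop).const_mul A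
    rw [mul_zero] at h1
    exact h1.eventually_le_const (by positivity)
  have hlim2 : ∀ᶠ k : ℕ in atTop, A / (k : ℝ) ≤ 1 / 2 :=
    (tendsto_const_div_atTop_nhds_zero_nat A).eventually_le_const (by norm_num)
  obtain ⟨N, hN⟩ := eventually_atTop.1 (h.and (hlim.and (hlim2.and (eventually_ge_atTop 1))))
  -- The entry `2` makes `w k ^ μ ≥ 1` once `w k > K/2`, `4 * A` absorbs the growth from below
  -- `K/2`, `4 * A / c` lets the contraction beat the additive error, and `w N` starts the
  -- induction.
  refine ⟨max (max 2 (4 * A)) (max (4 * A / c) (w N)), eventually_atTop.2 ⟨N, fun k hk => ?_⟩⟩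
  set K := max (max 2 (4 * A)) (max (4 * A / c) (w N)) with hK
  have hK2 : 2 ≤ K := (le_max_left _ _).trans (le_max_left _ _)
  have hKA : 4 * A ≤ K := (le_max_right _ _).trans (le_max_left _ _)
  have hKc : 4 * A ≤ K * c :=
    (div_le_iff₀ hcpos).1 ((le_max_left _ _).trans (le_max_right _ _))
  induction k, hk using Nat.le_induction with
  | base => exact (le_max_right _ _).trans (le_max_right _ _)
  | succ k hk ih =>
    obtain ⟨h1, h2, h3, h4⟩ := hN k hk
    have hk1 : (1 : ℝ) ≤ k := by exact_mod_cast h4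
    have hk0 : (0 : ℝ) < k := by linarith
    have hAk : 0 ≤ A / (k : ℝ) := by positivity
    have hpe : (k : ℝ) ^ (-e) ≤ (k : ℝ) ^ (-s) :=
      Real.rpow_le_rpow_of_exponent_le hk1 (by linarith)
    have hps : (k : ℝ) ^ (-s) ≤ 1 := Real.rpow_le_one_of_one_le_of_nonpos hk1 (by linarith)
    have hps0 : 0 < (k : ℝ) ^ (-s) := by positivity
    refine h1.trans ?_
    rcases le_or_gt (w k) (K / 2) with hwk | hwk
    · have h5 : 0 ≤ min (1 / 2) (b * w k ^ μ * (k : ℝ) ^ (-s)) * w k :=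
        mul_nonneg (le_min (by norm_num) (mul_nonneg (mul_nonneg hb.le
          (Real.rpow_nonneg (hw k) _)) hps0.le)) (hw k)
      calc (1 + A / k) * (w k - min (1 / 2) (b * w k ^ μ * (k : ℝ) ^ (-s)) * w k)
            + A * (k : ℝ) ^ (-e)
          ≤ (1 + 1 / 2) * (K / 2) + A * 1 := by
            gcongr
            · have := mul_le_mul_of_nonneg_right
                (min_le_left (1 / 2) (b * w k ^ μ * (k : ℝ) ^ (-s))) (hw k)
              linarith [hw k]
            · linarith
            · exact hpe.trans hps
        _ ≤ K := by linarith
    · have hw1 : 1 ≤ w k ^ μ := Real.one_le_rpow (by linarith) hμ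
      have h5 : c * (k : ℝ) ^ (-s) ≤ min (1 / 2) (b * w k ^ μ * (k : ℝ) ^ (-s)) := by
        refine le_min ?_ ?_
        · calc c * (k : ℝ) ^ (-s) ≤ 1 / 2 * 1 := by
                gcongr
                exact min_le_left _ _
            _ = 1 / 2 := mul_one _
        · gcongr
          calc c ≤ b := min_le_right _ _
            _ ≤ b * w k ^ μ := le_mul_of_one_le_right hb.le hw1
      -- As `s < 1`, the relative growth `A/k` uses at most half of the contraction.
      have h6 : A / k ≤ c / 2 * (k : ℝ) ^ (-s) := by
        have e1 : A / (k : ℝ) = A * (k : ℝ) ^ (-(1 - s)) * (k : ℝ) ^ (-s) := by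
          rw [mul_assoc, ← Real.rpow_add hk0, show -(1 - s) + -s = -1 by ring,
            Real.rpow_neg_one, div_eq_mul_inv]
        rw [e1]
        gcongr
      calc (1 + A / k) * (w k - min (1 / 2) (b * w k ^ μ * (k : ℝ) ^ (-s)) * w k)
            + A * (k : ℝ) ^ (-e)
          ≤ (1 + A / k) * (w k - c * (k : ℝ) ^ (-s) * w k) + A * (k : ℝ) ^ (-s) := by
            have := hw k
            gcongr
        _ = w k + (A / k - c * (k : ℝ) ^ (-s)) * w k - A / k * (c * (k : ℝ) ^ (-s) * w k)
            + A * (k : ℝ) ^ (-s) := by ring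
        _ ≤ w k + (-(c / 2 * (k : ℝ) ^ (-s))) * w k - 0 + A * (k : ℝ) ^ (-s) := by
            have := hw k
            gcongr
            · linarith
            · positivity
        _ ≤ w k + (-(c / 2 * (k : ℝ) ^ (-s))) * (K / 2) - 0 + A * (k : ℝ) ^ (-s) := by
            have : c / 2 * (k : ℝ) ^ (-s) * (K / 2) ≤ c / 2 * (k : ℝ) ^ (-s) * w k := by
              gcongr
            linarith
        _ ≤ K := by nlinarith [mul_le_mul_of_nonneg_right hKc hps0.le]

/-- The rescaled sequence `k^r T k` satisfies a recursion of the same shape with `s = rμ + τ` and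
additive exponent `e = 1 + τ - r`; the requirement `s ≤ e` is exactly `r(1 + μ) ≤ 1`. -/
theorem isBigO_rpow_of_recursion {T : ℕ → ℝ} {a b μ τ r : ℝ} (hT : ∀ k, 0 ≤ T k) (ha : 0 ≤ a)
    (hb : 0 < b) (hμ : 0 ≤ μ) (hτ : 0 ≤ τ) (hr0 : 0 ≤ r) (hr1 : r ≤ 1) (hs : r * μ + τ < 1)
    (hr : r * (1 + μ) ≤ 1)
    (h : ∀ᶠ k : ℕ in atTop, T (k + 1) ≤
      (1 + a / k) * (T k - min (1 / 2) (b * T k ^ μ * (k : ℝ) ^ (-τ)) * T k)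
        + a * (k : ℝ) ^ (-(1 + τ))) :
    T =O[atTop] fun k : ℕ => (k : ℝ) ^ (-r) := by
  have hw (k : ℕ) : 0 ≤ (k : ℝ) ^ r * T k := mul_nonneg (by positivity) (hT k)
  obtain ⟨K, hK⟩ := bounded_of_recursion (w := fun k : ℕ => (k : ℝ) ^ r * T k) (A := 1 + 2 * a)
    (b := b) (μ := μ) (s := r * μ + τ) (e := 1 + τ - r) hw (by positivity) hb hμ (by positivity) hs
    (by linarith) (by
      filter_upwards [h, eventually_ge_atTop 1] with k hk h1
      have hk1 : (1 : ℝ) ≤ k := by exact_mod_cast h1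
      have hk0 : (0 : ℝ) < k := by linarith
      have e1 : ((k : ℝ) ^ r * T k) ^ μ * (k : ℝ) ^ (-(r * μ + τ)) = T k ^ μ * (k : ℝ) ^ (-τ) := by
        rw [Real.mul_rpow (by positivity) (hT k), ← Real.rpow_mul hk0.le, mul_right_comm,
          ← Real.rpow_add hk0, show r * μ + -(r * μ + τ) = -τ by ring, mul_comm]
      have e2 : (k : ℝ) ^ (-(1 + τ - r)) = (k : ℝ) ^ r * (k : ℝ) ^ (-(1 + τ)) := by
        rw [← Real.rpow_add hk0]; ring_nf
      rw [mul_assoc b, e1, ← mul_assoc b, e2]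
      set q := min (1 / 2) (b * T k ^ μ * (k : ℝ) ^ (-τ)) with hq
      have hq2 : q * T k ≤ 1 / 2 * T k := mul_le_mul_of_nonneg_right (min_le_left _ _) (hT k)
      have hpow : ((k + 1 : ℕ) : ℝ) ^ r ≤ (1 + 1 / k) * (k : ℝ) ^ r := by
        have : ((k + 1 : ℕ) : ℝ) = (1 + 1 / k) * k := by push_cast; field_simp
        rw [this, Real.mul_rpow (by positivity) hk0.le]
        gcongr
        calc (1 + 1 / (k : ℝ)) ^ r ≤ (1 + 1 / (k : ℝ)) ^ (1 : ℝ) :=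
              Real.rpow_le_rpow_of_exponent_le (by simp) hr1
          _ = 1 + 1 / k := Real.rpow_one _
      have hinv : 1 / (k : ℝ) ≤ 1 := by rw [div_le_one hk0]; exact hk1
      have hTq : 0 ≤ T k - q * T k := by linarith [hT k]
      calc ((k + 1 : ℕ) : ℝ) ^ r * T (k + 1)
          ≤ (1 + 1 / k) * (k : ℝ) ^ r * ((1 + a / k) * (T k - q * T k)
            + a * (k : ℝ) ^ (-(1 + τ))) := by
            gcongr
            exact hT _
        _ = ((1 + 1 / k) * (1 + a / k)) * ((k : ℝ) ^ r * (T k - q * T k))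
            + (1 + 1 / k) * a * ((k : ℝ) ^ r * (k : ℝ) ^ (-(1 + τ))) := by ring
        _ ≤ (1 + (1 + 2 * a) / k) * ((k : ℝ) ^ r * (T k - q * T k))
            + (1 + 2 * a) * ((k : ℝ) ^ r * (k : ℝ) ^ (-(1 + τ))) := by
            -- The cross term `a/k²` is at most `a/k`, whence the `2 * a`.
            gcongr
            · have : 1 / (k : ℝ) * (a / k) ≤ 1 * (a / k) := by gcongr
              have e : (1 + 2 * a) / (k : ℝ) = 1 / k + a / k + a / k := by ring
              rw [e]; nlinarith
            · nlinarith
        _ = _ := by ring)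
  refine IsBigO.of_bound K ?_
  filter_upwards [hK, eventually_ge_atTop 1] with k hk h1
  have hk0 : (0 : ℝ) < k := by exact_mod_cast h1
  rw [Real.norm_of_nonneg (hT k), Real.norm_of_nonneg (by positivity), Real.rpow_neg hk0.le,
    ← div_eq_mul_inv, le_div_iff₀ (by positivity), mul_comm]
  exact hk

end CGAL

/-! ### The generated sequence -/

namespace CGAL

variable {n m : ℕ} {f : E n → ℝ} {g : Fin m → E n → ℝ} {C : Set (E n)} {Lf τ : ℝ}
  {Lg B : Fin m → ℝ} {l : ℝ} {xs : E n} {zs : E m}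
  {α lam σ : ℕ → ℝ} {x : ℕ → E n} {z : ℕ → E m} {v : ℕ → E n}

theorem IsGenerated.x_mem (hC : Convex ℝ C) (halg : IsGenerated f g C α lam σ x z v) (k : ℕ) :
    x k ∈ C := by
  induction k with
  | zero => exact halg.x_zero
  | succ k ih =>
    rw [halg.x_succ]
    exact hC.add_smul_sub_mem ih (halg.v_mem k).1 (halg.alpha_mem k)

/-- Since `σ ≤ λ`, one update removes at most the fraction `σ/λ ≤ 1` of a multiplier. -/
theorem IsGenerated.z_nonneg (halg : IsGenerated f g C α lam σ x z v) (k : ℕ) (i : Fin m) :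
    0 ≤ z k i := by
  induction k with
  | zero => exact halg.z_zero i
  | succ k ih =>
    rw [halg.z_succ]
    have h1 := mul_le_mul_of_nonneg_left (le_max_left (-(z k i / lam k)) (g i (x (k + 1))))
      (halg.sigma_pos k).le
    have h2 : σ k * (z k i / lam k) ≤ z k i := by
      rw [mul_div_left_comm]
      exact mul_le_of_le_one_right ih ((div_le_one (halg.lam_pos k)).2 (halg.sigma_le k))
    linarith

theorem ProblemAssumption.exists_abs_le (hprob : ProblemAssumption f g C Lf Lg) :
    ∃ M, 0 ≤ M ∧ ∀ x ∈ C, ∀ i, |g i x| ≤ M := by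
  choose M hM using fun i => hprob.C_compact.exists_bound_of_continuousOn
    (hprob.g_diff i).continuous.continuousOn
  refine ⟨∑ i, |M i|, by positivity, fun x hx i => ?_⟩
  exact ((hM i x hx).trans (le_abs_self _)).trans
    (Finset.single_le_sum (f := fun i => |M i|) (fun i _ => abs_nonneg _) (Finset.mem_univ i))

theorem IsGenerated.exists_z_le (hprob : ProblemAssumption f g C Lf Lg)
    (halg : IsGenerated f g C α lam σ x z v) : ∃ Z, 0 ≤ Z ∧ ∀ k i, z k i ≤ Z := by
  obtain ⟨M, hM0, hM⟩ := hprob.exists_abs_le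
  have h (k : ℕ) (i : Fin m) : z k i ≤ z 0 i + M * ∑ j ∈ Finset.range k, σ j := by
    induction k with
    | zero => simp
    | succ k ih =>
      rw [halg.z_succ, Finset.sum_range_succ]
      have h1 : max (-(z k i / lam k)) (g i (x (k + 1))) ≤ M := by
        refine max_le ?_ ((le_abs_self _).trans (hM _ (halg.x_mem hprob.C_convex _) i))
        have := div_nonneg (halg.z_nonneg k i) (halg.lam_pos k).le
        linarith
      have h2 := mul_le_mul_of_nonneg_left h1 (halg.sigma_pos k).le
      linarith
  have hσ : 0 ≤ ∑' j, σ j := tsum_nonneg fun j => (halg.sigma_pos j).le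
  have hz0 := halg.z_zero
  refine ⟨∑ i, z 0 i + M * ∑' j, σ j, ?_, fun k i => (h k i).trans ?_⟩
  · exact add_nonneg (Finset.sum_nonneg fun i _ => hz0 i) (mul_nonneg hM0 hσ)
  · gcongr
    · exact Finset.single_le_sum (f := fun i => z 0 i) (fun i _ => hz0 i) (Finset.mem_univ i)
    · exact halg.sigma_summable.sum_le_tsum _ fun j _ => (halg.sigma_pos j).le

theorem IsGenerated.exists_sum_sq_le (hprob : ProblemAssumption f g C Lf Lg)
    (halg : IsGenerated f g C α lam σ x z v) (zs : E m) :
    ∃ D, 0 ≤ D ∧ ∀ k, ∑ i, (z k i - zs i) ^ 2 ≤ D := by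
  obtain ⟨Z, hZ0, hZ⟩ := halg.exists_z_le hprob
  refine ⟨∑ i, (Z + |zs i|) ^ 2, by positivity, fun k => Finset.sum_le_sum fun i _ => ?_⟩
  have h1 := halg.z_nonneg k i
  have h2 := hZ k i
  exact sq_le_sq' (by linarith [le_abs_self (zs i)]) (by linarith [neg_abs_le (zs i)])

theorem IsGenerated.exists_LPsi_le (hprob : ProblemAssumption f g C Lf Lg)
    (halg : IsGenerated f g C α lam σ x z v) :
    ∃ c, 0 < c ∧ ∀ k, LPsi g Lg B (lam k) (x k) (z k) + Lf ≤ c * lam k := by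
  obtain ⟨M, hM0, hM⟩ := hprob.exists_abs_le
  obtain ⟨Z, hZ0, hZ⟩ := halg.exists_z_le hprob
  have hl0 := halg.lam_pos 0
  have hLf := hprob.Lf_pos
  have hLg := hprob.Lg_pos
  refine ⟨∑ i, (B i ^ 2 + Lg i * (M + Z / lam 0)) + Lf / lam 0, ?_, fun k => ?_⟩
  · refine add_pos_of_nonneg_of_pos (Finset.sum_nonneg fun i _ => ?_) (by positivity)
    have := (hLg i).le
    positivity
  · have hl := halg.lam_pos k
    have hmono : lam 0 ≤ lam k := halg.lam_mono.monotone (Nat.zero_le k)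
    have hle (a : ℝ) (ha : 0 ≤ a) : a ≤ a / lam 0 * lam k := by
      rw [div_mul_eq_mul_div, le_div_iff₀ hl0]
      gcongr
    rw [add_mul, Finset.sum_mul]
    refine add_le_add (Finset.sum_le_sum fun i _ => ?_) (hle Lf hLf.le)
    have h1 : max (lam k * g i (x k) + z k i) 0 ≤ lam k * M + Z / lam 0 * lam k := by
      refine max_le (add_le_add ?_ ((hZ k i).trans (hle Z hZ0))) (by positivity)
      have := (le_abs_self _).trans (hM _ (halg.x_mem hprob.C_convex k) i)
      gcongr
    have h2 := mul_le_mul_of_nonneg_left h1 (hLg i).le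
    linarith

theorem ShortStepParams.exists_lam_bounds (hpar : ShortStepParams f g Lf Lg B τ α lam σ x z v)
    (halg : IsGenerated f g C α lam σ x z v) :
    ∃ c c', 0 < c ∧ 0 < c' ∧
      ∀ᶠ k : ℕ in atTop, c * (k : ℝ) ^ τ ≤ lam k ∧ lam k ≤ c' * (k : ℝ) ^ τ := by
  obtain ⟨c', hc', h'⟩ := hpar.lam_theta.1.exists_pos
  obtain ⟨c, hc, h⟩ := hpar.lam_theta.2.exists_pos
  refine ⟨c⁻¹, c', inv_pos.2 hc, hc', ?_⟩
  filter_upwards [h.bound, h'.bound] with k h1 h2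
  rw [Real.norm_of_nonneg (halg.lam_pos k).le, Real.norm_of_nonneg (by positivity)] at h1 h2
  exact ⟨by rwa [inv_mul_le_iff₀ hc], h2⟩

/-- Both `σ_k` and the increments of `λ` are `O(k^(-(1-τ)))`. Dividing by `λ_k ~ k^τ` once gives
`1/k`, and twice gives `k^(-(1+τ))`. -/
theorem ShortStepParams.exists_perturbation_bounds
    (hpar : ShortStepParams f g Lf Lg B τ α lam σ x z v)
    (halg : IsGenerated f g C α lam σ x z v) {D : ℝ} (hD : 0 ≤ D) :
    ∃ a, 0 ≤ a ∧ ∀ᶠ k : ℕ in atTop,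
      (σ k + (lam (k + 1) - lam k) / 2) * (4 / lam k) ≤ a / k ∧
      (σ k + (lam (k + 1) - lam k) / 2) * (4 * D / lam k ^ 2) ≤ a * (k : ℝ) ^ (-(1 + τ)) := by
  obtain ⟨c, _, hc, _, hlam⟩ := hpar.exists_lam_bounds halg
  obtain ⟨γ, hγ, hσ⟩ := hpar.sigma_theta
  obtain ⟨d, hd, hd'⟩ := hpar.lam_diff.exists_nonneg
  obtain ⟨e, he, he'⟩ := hσ.1.exists_nonneg
  refine ⟨(e + d / 2) * (4 / c) + (e + d / 2) * (4 * D / c ^ 2), by positivity, ?_⟩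
  filter_upwards [hlam, hd'.bound, he'.bound, eventually_ge_atTop 1] with k h1 h2 h3 h4
  have hk1 : (1 : ℝ) ≤ k := by exact_mod_cast h4
  have hk0 : (0 : ℝ) < k := by linarith
  have hl := halg.lam_pos k
  rw [Real.norm_of_nonneg (by positivity : 0 ≤ (k : ℝ) ^ (-(1 - τ)))] at h2
  rw [Real.norm_of_nonneg (by positivity : 0 ≤ (k : ℝ) ^ (-(1 + γ)))] at h3
  have h2' := (le_abs_self _).trans h2
  have h3' := (le_abs_self _).trans h3
  have h5 : (k : ℝ) ^ (-(1 + γ)) ≤ (k : ℝ) ^ (-(1 - τ)) :=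
    Real.rpow_le_rpow_of_exponent_le hk1 (by linarith [hpar.tau_mem.1])
  have hη : σ k + (lam (k + 1) - lam k) / 2 ≤ (e + d / 2) * (k : ℝ) ^ (-(1 - τ)) := by
    have := mul_le_mul_of_nonneg_left h5 he
    linarith
  have hη0 : 0 ≤ σ k + (lam (k + 1) - lam k) / 2 := by
    have := halg.lam_mono.monotone (Nat.le_succ k)
    have := halg.sigma_pos k
    simp only [Nat.succ_eq_add_one] at *
    linarith
  have hp : 0 < (k : ℝ) ^ τ := by positivity
  constructor
  · calc (σ k + (lam (k + 1) - lam k) / 2) * (4 / lam k)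
        ≤ (e + d / 2) * (k : ℝ) ^ (-(1 - τ)) * (4 / (c * (k : ℝ) ^ τ)) := by
          gcongr
          exact h1.1
      _ = (e + d / 2) * (4 / c) * ((k : ℝ) ^ (-(1 - τ)) * (k : ℝ) ^ (-τ)) := by
          rw [Real.rpow_neg hk0.le τ]; field_simp
      _ = (e + d / 2) * (4 / c) / k := by
          rw [← Real.rpow_add hk0, show -(1 - τ) + -τ = -1 by ring, Real.rpow_neg_one]
          rfl
      _ ≤ _ := by
          gcongr
          exact le_add_of_nonneg_right (by positivity)
  · calc (σ k + (lam (k + 1) - lam k) / 2) * (4 * D / lam k ^ 2)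
        ≤ (e + d / 2) * (k : ℝ) ^ (-(1 - τ)) * (4 * D / (c * (k : ℝ) ^ τ) ^ 2) := by
          gcongr
          exact h1.1
      _ = (e + d / 2) * (4 * D / c ^ 2) *
          ((k : ℝ) ^ (-(1 - τ)) * ((k : ℝ) ^ (-τ) * (k : ℝ) ^ (-τ))) := by
          rw [Real.rpow_neg hk0.le τ]; field_simp
      _ = (e + d / 2) * (4 * D / c ^ 2) * (k : ℝ) ^ (-(1 + τ)) := by
          rw [← Real.rpow_add hk0, ← Real.rpow_add hk0]
          ring_nf
      _ ≤ _ := by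
          gcongr
          exact le_add_of_nonneg_left (by positivity)

/-- The one-step recursion for `T_k`, given a bound of the step `v - x` in terms of the gap. -/
theorem IsGenerated.T_succ_le (hprob : ProblemAssumption f g C Lf Lg) (hB : GradBound g C B)
    (halg : IsGenerated f g C α lam σ x z v)
    (hpar : ShortStepParams f g Lf Lg B τ α lam σ x z v) :
    ∃ a c, 0 ≤ a ∧ 0 < c ∧ ∀ μ A : ℝ, 0 ≤ μ → 0 < A → ∀ᶠ k : ℕ in atTop,
      ‖v k - x k‖ ^ 2 ≤ A * gap f g (lam k) (x k) (z k) (v k) ^ (1 - μ) →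
      T f g C (lam (k + 1)) (x (k + 1)) (z (k + 1)) ≤
        (1 + a / k) * (T f g C (lam k) (x k) (z k) -
          min (1 / 2) (T f g C (lam k) (x k) (z k) ^ μ / (2 * (c * lam k) * A)) *
            T f g C (lam k) (x k) (z k)) + a * (k : ℝ) ^ (-(1 + τ)) := by
  obtain ⟨xs, zs, hk⟩ := hprob.kkt
  obtain ⟨D, hD0, hD⟩ := halg.exists_sum_sq_le hprob zs
  obtain ⟨a, ha, hev⟩ := hpar.exists_perturbation_bounds halg hD0
  obtain ⟨c, hc, hL⟩ := halg.exists_LPsi_le (B := B) hprob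
  -- `a` and `c` do not depend on `μ` and `A`, which are chosen differently in the two uses.
  refine ⟨a, c, ha, hc, fun μ A hμ hA => ?_⟩
  filter_upwards [hev] with k hη hd
  have hl := halg.lam_pos k
  have h1 := hk.T_shortStep_le hprob hB hl (halg.x_mem hprob.C_convex k) (z k) (halg.v_mem k)
    hμ hA hd (hL k)
  have h2 := hk.T_dual_update_le hprob hl (halg.lam_mono.monotone (Nat.le_succ k))
    (halg.sigma_pos k).le (halg.x_mem hprob.C_convex (k + 1)) (hD k) (halg.z_succ k)
  rw [← hpar.alpha_eq k, ← halg.x_succ k] at h1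
  have hT := T_nonneg (f := f) (g := g) (C := C) (l := lam k) (x (k + 1)) (z k)
  refine h2.trans ?_
  set S := T f g C (lam k) (x (k + 1)) (z k)
  have h3 := mul_le_mul_of_nonneg_right hη.1 hT
  have h4 : 0 ≤ 1 + a / (k : ℝ) := by positivity
  have h5 := mul_le_mul_of_nonneg_left h1 h4
  have e1 : (σ k + (lam (k + 1) - lam k) / 2) * (4 * S / lam k + 4 * D / lam k ^ 2) =
    (σ k + (lam (k + 1) - lam k) / 2) * (4 / lam k) * S +
      (σ k + (lam (k + 1) - lam k) / 2) * (4 * D / lam k ^ 2) := by ring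
  rw [e1]
  linarith [hη.2]

/-- The first use of the recursion: with `μ = 1` the step bound is just the diameter bound on `C`.
The contraction factor is then proportional to `T/λ` itself, so `T/λ` obeys the recursion with `τ =
0` and decays like `k^(-1/2)`. -/
theorem IsGenerated.tendsto_T_div_lam (hprob : ProblemAssumption f g C Lf Lg)
    (hB : GradBound g C B) (halg : IsGenerated f g C α lam σ x z v)
    (hpar : ShortStepParams f g Lf Lg B τ α lam σ x z v) :
    Tendsto (fun k => T f g C (lam k) (x k) (z k) / lam k) atTop (nhds 0) := by
  obtain ⟨a, c, ha, hc, hrec⟩ := halg.T_succ_le hprob hB hpar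
  obtain ⟨R, hR⟩ := hprob.C_compact.isBounded.exists_norm_le
  have hl0 := halg.lam_pos 0
  have hA : 0 < (2 * R) ^ 2 + 1 := by positivity
  have ht (k : ℕ) : 0 ≤ T f g C (lam k) (x k) (z k) / lam k :=
    div_nonneg (T_nonneg _ _) (halg.lam_pos k).le
  have hO := isBigO_rpow_of_recursion (a := a + a / lam 0) (b := 1 / (2 * c * ((2 * R) ^ 2 + 1)))
    (μ := 1) (τ := 0) (r := 1 / 2) ht (by positivity) (by positivity) zero_le_one le_rfl
    (by norm_num) (by norm_num) (by norm_num) (by norm_num) (by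
      filter_upwards [hrec 1 ((2 * R) ^ 2 + 1) zero_le_one hA, eventually_ge_atTop 1] with k hk h1
      have hk1 : (1 : ℝ) ≤ k := by exact_mod_cast h1
      have hk0 : (0 : ℝ) < k := by linarith
      have hl := halg.lam_pos k
      have hl' := halg.lam_pos (k + 1)
      have hmono : lam k ≤ lam (k + 1) := halg.lam_mono.monotone (Nat.le_succ k)
      have hmono0 : lam 0 ≤ lam k := halg.lam_mono.monotone (Nat.zero_le k)
      have hd : ‖v k - x k‖ ^ 2 ≤
          ((2 * R) ^ 2 + 1) * gap f g (lam k) (x k) (z k) (v k) ^ ((1 : ℝ) - 1) := by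
        rw [sub_self, Real.rpow_zero, mul_one]
        have h2 : ‖v k - x k‖ ≤ 2 * R := by
          have := norm_sub_le (v k) (x k)
          linarith [hR _ (halg.v_mem k).1, hR _ (halg.x_mem hprob.C_convex k)]
        have := pow_le_pow_left₀ (norm_nonneg _) h2 2
        linarith
      have h3 := hk hd
      have hT := T_nonneg (f := f) (g := g) (C := C) (l := lam k) (x k) (z k)
      have hT' := T_nonneg (f := f) (g := g) (C := C) (l := lam (k + 1)) (x (k + 1)) (z (k + 1))
      set S := T f g C (lam k) (x k) (z k)
      set S' := T f g C (lam (k + 1)) (x (k + 1)) (z (k + 1))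
      rw [Real.rpow_one] at h3
      rw [Real.rpow_one, neg_zero, Real.rpow_zero, mul_one, add_zero]
      have e1 : 1 / (2 * c * ((2 * R) ^ 2 + 1)) * (S / lam k) =
          S / (2 * (c * lam k) * ((2 * R) ^ 2 + 1)) := by
        field_simp
      rw [e1]
      set p := min (1 / 2) (S / (2 * (c * lam k) * ((2 * R) ^ 2 + 1)))
      have hp : p ≤ 1 := (min_le_left _ _).trans (by norm_num)
      have hpS : 0 ≤ S / lam k - p * (S / lam k) := by
        have := mul_le_mul_of_nonneg_right hp (ht k)
        linarith
      have hpow : (k : ℝ) ^ (-(1 + τ)) ≤ (k : ℝ) ^ (-1 : ℝ) :=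
        Real.rpow_le_rpow_of_exponent_le hk1 (by linarith [hpar.tau_mem.1])
      calc S' / lam (k + 1) ≤ S' / lam k := by gcongr
        _ ≤ ((1 + a / k) * (S - p * S) + a * (k : ℝ) ^ (-(1 + τ))) / lam k := by gcongr
        _ = (1 + a / k) * (S / lam k - p * (S / lam k)) + a / lam k * (k : ℝ) ^ (-(1 + τ)) := by
            ring
        _ ≤ (1 + (a + a / lam 0) / k) * (S / lam k - p * (S / lam k)) +
            (a + a / lam 0) * (k : ℝ) ^ (-1 : ℝ) := by
            gcongr
            · exact le_add_of_nonneg_right (by positivity)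
            · calc a / lam k ≤ a / lam 0 := by gcongr
                _ ≤ a + a / lam 0 := le_add_of_nonneg_left ha)
  exact hO.trans_tendsto ((tendsto_rpow_neg_atTop (by norm_num)).comp tendsto_natCast_atTop_atTop)

/-- As `T/λ → 0`, the vector `u = max{-z/λ, g}` tends to `0` and dominates `g`. A constraint below
`-ε` has zero multiplier once `λ ε` exceeds the bound on `z`. -/
theorem IsGenerated.eventually_mem_setA (hprob : ProblemAssumption f g C Lf Lg)
    (hB : GradBound g C B) (halg : IsGenerated f g C α lam σ x z v)
    (hpar : ShortStepParams f g Lf Lg B τ α lam σ x z v) {ε : ℝ} (hε : 0 < ε) :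
    ∀ᶠ k in atTop, (x k, (WithLp.toLp 2 (mult g (lam k) (x k) (z k)) : E m)) ∈ setA g ε := by
  obtain ⟨xs, zs, hk⟩ := hprob.kkt
  obtain ⟨D, hD0, hD⟩ := halg.exists_sum_sq_le hprob zs
  obtain ⟨Z, hZ0, hZ⟩ := halg.exists_z_le hprob
  have hlim : Tendsto (fun k => 4 * (T f g C (lam k) (x k) (z k) / lam k) + 4 * D / lam k ^ 2)
      atTop (nhds 0) := by
    have h1 := (halg.tendsto_T_div_lam hprob hB hpar).const_mul 4
    have h2 : Tendsto (fun k => 4 * D / lam k ^ 2) atTop (nhds 0) :=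
      tendsto_const_nhds.div_atTop ((tendsto_pow_atTop two_ne_zero).comp halg.lam_tendsto)
    simpa using h1.add h2
  filter_upwards [hlim.eventually_lt_const (pow_pos hε 2),
    halg.lam_tendsto.eventually_ge_atTop (Z / ε)] with k h1 h2
  have hl := halg.lam_pos k
  refine ⟨fun i => ?_, fun i => mult_nonneg _ _ _, fun i hi => ?_⟩
  · have h3 := hk.sum_sq_mult_sub_self_le hprob hl (halg.x_mem hprob.C_convex k) (hD k)
    have h4 := Finset.single_le_sum
      (f := fun i => ((mult g (lam k) (x k) (z k) i - z k i) / lam k) ^ 2)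
      (fun i _ => sq_nonneg _) (Finset.mem_univ i)
    have h5 : g i (x k) ≤ (mult g (lam k) (x k) (z k) i - z k i) / lam k := by
      rw [mult_sub_div_eq hl]
      exact le_max_right _ _
    refine h5.trans (abs_le_of_sq_le_sq' ?_ hε.le).2
    have h6 := h4.trans h3
    rw [mul_div_assoc] at h6
    exact h6.trans h1.le
  · change mult g (lam k) (x k) (z k) i = 0
    rw [div_le_iff₀ hε] at h2
    have hi' : g i (x k) < -ε := hi
    have := mul_lt_mul_of_pos_left hi' hl
    exact max_eq_right (by linarith [hZ k i])

theorem IsGenerated.T_isBigO {ν q μ r : ℝ} (hprob : ProblemAssumption f g C Lf Lg)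
    (hB : GradBound g C B) (hC : UniformlyConvexSet ν q C)
    (haway : LagrangianGradBoundedAway f g C) (halg : IsGenerated f g C α lam σ x z v)
    (hpar : ShortStepParams f g Lf Lg B τ α lam σ x z v) (hμ : μ = 1 - 2 / q)
    (hr0 : 0 ≤ r) (hr1 : r * (1 + μ) ≤ 1) (hr2 : r * (1 + μ) ≤ 2 - 2 * τ) :
    (fun k => T f g C (lam k) (x k) (z k)) =O[atTop] fun k : ℕ => (k : ℝ) ^ (-r) := by
  obtain ⟨a, c, ha, hc, hrec⟩ := halg.T_succ_le hprob hB hpar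
  obtain ⟨_, c', _, hc', hlam⟩ := hpar.exists_lam_bounds halg
  obtain ⟨ε, hε, ζ, hζ, haway⟩ := haway
  have hq2 := hC.q_ge
  have hq : 0 < q := by linarith
  have hν := hC.nu_pos
  have hμ0 : 0 ≤ μ := by
    have : 2 / q ≤ 1 := (div_le_one hq).2 hq2
    linarith
  have hμ1 : μ < 1 := by
    have : 0 < 2 / q := by positivity
    linarith
  have hA : 0 < ((ν / 2 * ζ) ^ (1 - μ))⁻¹ := by positivity
  have hmr : 0 ≤ r * μ := mul_nonneg hr0 hμ0
  have hτ := hpar.tau_mem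
  -- For `μ, r > 0`, `μ < 1` gives `2rμ < r(1 + μ) ≤ 2 - 2τ`.
  have hs : r * μ + τ < 1 := by
    rcases hμ0.eq_or_lt with h | h
    · rw [← h, mul_zero, zero_add]; exact hτ.2
    · rcases hr0.eq_or_lt with h' | h'
      · rw [← h', zero_mul, zero_add]; exact hτ.2
      · nlinarith [mul_pos h' (sub_pos.2 hμ1)]
  refine isBigO_rpow_of_recursion (a := a) (b := 1 / (2 * (c * c') * ((ν / 2 * ζ) ^ (1 - μ))⁻¹))
    (μ := μ) (τ := τ) (fun k => T_nonneg _ _) ha (by positivity) hμ0 hτ.1.le hr0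
    (by linarith) hs hr1 ?_
  filter_upwards [hrec μ _ hμ0 hA, hlam, halg.eventually_mem_setA hprob hB hpar hε,
    eventually_ge_atTop 1] with k hk hl2 hmem h1
  have hk0 : (0 : ℝ) < k := by exact_mod_cast h1
  have hl := halg.lam_pos k
  have hx := halg.x_mem hprob.C_convex k
  have hgrad : ζ ≤ ‖gradF f g (lam k) (x k) (z k)‖ := by
    rw [gradF_eq hprob.f_diff hprob.g_diff hl]
    exact haway (x k) (WithLp.toLp 2 (mult g (lam k) (x k) (z k))) hmem hx
  have hG : ν / 2 * ζ * ‖v k - x k‖ ^ q ≤ gap f g (lam k) (x k) (z k) (v k) := by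
    refine le_trans ?_ (hC.le_inner_sub (halg.v_mem k) hx)
    gcongr
  have hd : ‖v k - x k‖ ^ 2 ≤
      ((ν / 2 * ζ) ^ (1 - μ))⁻¹ * gap f g (lam k) (x k) (z k) (v k) ^ (1 - μ) := by
    rw [le_inv_mul_iff₀ (by positivity)]
    have e : ‖v k - x k‖ ^ 2 = (‖v k - x k‖ ^ q) ^ (1 - μ) := by
      rw [← Real.rpow_mul (norm_nonneg _), hμ, sub_sub_cancel, mul_div_cancel₀ _ hq.ne',
        Real.rpow_two]
    rw [e, ← Real.mul_rpow (by positivity) (by positivity)]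
    exact Real.rpow_le_rpow (by positivity) hG (by linarith)
  refine (hk hd).trans ?_
  have hT := T_nonneg (f := f) (g := g) (C := C) (l := lam k) (x k) (z k)
  set S := T f g C (lam k) (x k) (z k)
  have hb : 1 / (2 * (c * c') * ((ν / 2 * ζ) ^ (1 - μ))⁻¹) * S ^ μ * (k : ℝ) ^ (-τ) ≤
      S ^ μ / (2 * (c * lam k) * ((ν / 2 * ζ) ^ (1 - μ))⁻¹) := by
    have e : 1 / (2 * (c * c') * ((ν / 2 * ζ) ^ (1 - μ))⁻¹) * S ^ μ * (k : ℝ) ^ (-τ) =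
        S ^ μ / (2 * (c * (c' * (k : ℝ) ^ τ)) * ((ν / 2 * ζ) ^ (1 - μ))⁻¹) := by
      rw [Real.rpow_neg hk0.le]; field_simp
    rw [e]
    gcongr
    exact hl2.2
  gcongr

/-! ### From `T_k` to objective error and infeasibility -/

theorem sq_infeas_le (hl : 0 < l) (x : E n) (z : E m) :
    infeas g x ^ 2 ≤ ∑ i, ((mult g l x z i - z i) / l) ^ 2 := by
  rw [infeas, EuclideanSpace.real_norm_sq_eq]
  refine Finset.sum_le_sum fun i _ => ?_
  rw [mult_sub_div_eq hl]
  change (max (g i x) 0) ^ 2 ≤ _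
  rcases le_total (g i x) 0 with h | h
  · rw [max_eq_right h, zero_pow two_ne_zero]; exact sq_nonneg _
  · rw [max_eq_left h]
    exact pow_le_pow_left₀ h (le_max_right _ _) 2

theorem IsKKT.infeas_le (hprob : ProblemAssumption f g C Lf Lg) (hk : IsKKT f g C xs zs)
    (hl : 0 < l) {x : E n} (hx : x ∈ C) {z : E m} {D : ℝ} (hD : ∑ i, (z i - zs i) ^ 2 ≤ D) :
    infeas g x ≤ T f g C l x z + (1 + 4 * D) * (1 / l) := by
  have h := (sq_infeas_le hl x z).trans (hk.sum_sq_mult_sub_self_le hprob hl hx hD)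
  have hT := T_nonneg (f := f) (g := g) (C := C) (l := l) x z
  have hD0 : 0 ≤ D := (Finset.sum_nonneg fun i _ => sq_nonneg _).trans hD
  refine (abs_le_of_sq_le_sq' (h.trans ?_) (by positivity)).2
  set S := T f g C l x z
  have e : 4 * S / l + 4 * D / l ^ 2 = 4 * S * (1 / l) + 4 * D * (1 / l) ^ 2 := by
    field_simp
  rw [e]
  have hi : 0 < 1 / l := by positivity
  generalize 1 / l = j at *
  -- With `j = 1/l`, `(S + (1 + 4D) j)²` exceeds `4Sj + 4Dj²` by `(S - j)²` plus nonnegative terms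
  -- in `D`.
  nlinarith [sq_nonneg (S - j), mul_nonneg (mul_nonneg hT hD0) hi.le,
    mul_nonneg hD0 (sq_nonneg j), sq_nonneg (D * j)]

/-- Below `L*`, the Lagrangian inequality limits the deficit by the infeasibility; above, `Ψ ≥ -∑
zᵢ² / (2l)`. -/
theorem IsKKT.abs_sub_optVal_le (hprob : ProblemAssumption f g C Lf Lg)
    (hk : IsKKT f g C xs zs) (hl : 0 < l) {x : E n} (hx : x ∈ C) (z : E m) :
    |f x - optVal f g C| ≤
      T f g C l x z + (∑ i, z i ^ 2) / 2 * (1 / l) + (∑ i, zs i) * infeas g x := by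
  have hzs : 0 ≤ ∑ i, zs i := Finset.sum_nonneg fun i _ => hk.dual i
  have hinf : 0 ≤ infeas g x := norm_nonneg _
  have hT := T_nonneg (f := f) (g := g) (C := C) (l := l) x z
  have hz2 : 0 ≤ (∑ i, z i ^ 2) / 2 * (1 / l) := by positivity
  rw [abs_le]
  constructor
  · have h1 := hk.le_lagrangian hprob hx
    have h2 : ∑ i, zs i * g i x ≤ (∑ i, zs i) * infeas g x := by
      rw [Finset.sum_mul]
      refine Finset.sum_le_sum fun i _ => mul_le_mul_of_nonneg_left ?_ (hk.dual i)
      have h3 := PiLp.norm_apply_le (WithLp.toLp 2 fun i => max (g i x) 0 : E m) i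
      exact ((le_max_left _ _).trans (le_abs_self _)).trans h3
    rw [hk.optVal_eq hprob]
    linarith
  · have h1 : F f g l x z - optVal f g C ≤ T f g C l x z := le_max_left _ _
    rw [F, Psi_eq hl] at h1
    have h2 : ∑ i, -(z i ^ 2 / 2 * (1 / l)) ≤ ∑ i, (mult g l x z i ^ 2 - z i ^ 2) / (2 * l) := by
      refine Finset.sum_le_sum fun i _ => ?_
      have e : -(z i ^ 2 / 2 * (1 / l)) = (0 - z i ^ 2) / (2 * l) := by field_simp; ring
      rw [e]
      gcongr
      positivity
    rw [Finset.sum_neg_distrib, ← Finset.sum_mul, ← Finset.sum_div] at h2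
    have := mul_nonneg hzs hinf
    linarith

theorem IsGenerated.residual_isBigO {ρ : ℕ → ℝ} (hprob : ProblemAssumption f g C Lf Lg)
    (halg : IsGenerated f g C α lam σ x z v)
    (hT : (fun k => T f g C (lam k) (x k) (z k)) =O[atTop] ρ)
    (hl : (fun k => 1 / lam k) =O[atTop] ρ) :
    (fun k => max |f (x k) - optVal f g C| (infeas g (x k))) =O[atTop] ρ := by
  obtain ⟨xs, zs, hk⟩ := hprob.kkt
  obtain ⟨D, hD0, hD⟩ := halg.exists_sum_sq_le hprob zs
  -- Centred at `0`, the same bound controls `∑ zᵢ²`.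
  obtain ⟨Z, hZ0, hZ⟩ := halg.exists_sum_sq_le hprob 0
  have h1 : (fun k => infeas g (x k)) =O[atTop] ρ := by
    refine IsBigO.trans (IsBigO.of_bound 1 ?_) (hT.add (hl.const_mul_left (1 + 4 * D)))
    refine Eventually.of_forall fun k => ?_
    have h0 : 0 ≤ infeas g (x k) := norm_nonneg _
    rw [one_mul, Real.norm_of_nonneg h0]
    exact (hk.infeas_le hprob (halg.lam_pos k) (halg.x_mem hprob.C_convex k) (hD k)).trans
      (le_abs_self _)
  have h2 : (fun k => |f (x k) - optVal f g C|) =O[atTop] ρ := by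
    refine IsBigO.trans (IsBigO.of_bound 1 ?_) ((hT.add (hl.const_mul_left (Z / 2))).add
      (h1.const_mul_left (∑ i, zs i)))
    refine Eventually.of_forall fun k => ?_
    rw [one_mul, Real.norm_of_nonneg (abs_nonneg _)]
    refine (hk.abs_sub_optVal_le hprob (halg.lam_pos k) (halg.x_mem hprob.C_convex k)
      (z k)).trans (le_trans ?_ (le_abs_self _))
    have hl := halg.lam_pos k
    have h3 : ∑ i, z k i ^ 2 ≤ Z := by simpa using hZ k
    gcongr
  refine IsBigO.trans (IsBigO.of_bound 1 ?_) (h1.norm_left.add h2.norm_left)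
  refine Eventually.of_forall fun k => ?_
  rw [one_mul, Real.norm_of_nonneg (le_max_of_le_left (abs_nonneg _)),
    Real.norm_of_nonneg (add_nonneg (norm_nonneg _) (norm_nonneg _))]
  exact max_le ((le_abs_self _).trans (le_add_of_nonneg_left (norm_nonneg _)))
    ((le_abs_self _).trans (le_add_of_nonneg_right (norm_nonneg _)))

theorem rpow_neg_min_isBigO (a b : ℝ) :
    (fun k : ℕ => (k : ℝ) ^ (-(min a b))) =O[atTop]
      fun k : ℕ => max ((k : ℝ) ^ (-a)) ((k : ℝ) ^ (-b)) := by
  refine IsBigO.of_bound 1 (Eventually.of_forall fun k => ?_)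
  rw [one_mul, Real.norm_of_nonneg (by positivity), Real.norm_of_nonneg (by positivity)]
  rcases min_choice a b with h | h <;> rw [h]
  · exact le_max_left _ _
  · exact le_max_right _ _

end CGAL

theorem proposition5p5 {n m : ℕ} (f : E n → ℝ) (g : Fin m → E n → ℝ) (C : Set (E n))
    (Lf : ℝ) (Lg B : Fin m → ℝ) (ν q μ τ : ℝ)
    (α lam σ : ℕ → ℝ) (x : ℕ → E n) (z : ℕ → E m) (v : ℕ → E n)
    (hprob : CGAL.ProblemAssumption f g C Lf Lg)
    (hB : CGAL.GradBound g C B)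
    (hC : CGAL.UniformlyConvexSet ν q C)
    (haway : CGAL.LagrangianGradBoundedAway f g C)
    (halg : CGAL.IsGenerated f g C α lam σ x z v)
    (hpar : CGAL.ShortStepParams f g Lf Lg B τ α lam σ x z v)
    (hμ : μ = 1 - 2 / q) :
    (∀ k, x k ∈ C) ∧
    ((fun k : ℕ => CGAL.T f g C (lam k) (x k) (z k)) =O[atTop]
      fun k : ℕ => max ((k : ℝ) ^ (-(1 / (1 + μ)))) ((k : ℝ) ^ (-((2 - 2 * τ) / (1 + μ))))) ∧
    ((fun k : ℕ => max |f (x k) - CGAL.optVal f g C| (CGAL.infeas g (x k))) =O[atTop]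
      fun k : ℕ => max (max ((k : ℝ) ^ (-(1 / (1 + μ)))) ((k : ℝ) ^ (-((2 - 2 * τ) / (1 + μ)))))
        ((k : ℝ) ^ (-τ))) ∧
    (q = 2 → τ = 2 / 3 →
      (fun k : ℕ => max |f (x k) - CGAL.optVal f g C| (CGAL.infeas g (x k))) =O[atTop]
        fun k : ℕ => (k : ℝ) ^ (-(2 / 3 : ℝ))) := by
  have hτ := hpar.tau_mem
  have hμ0 : 0 ≤ μ := by
    have : 2 / q ≤ 1 := (div_le_one (by linarith [hC.q_ge])).2 hC.q_ge
    linarith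
  have hμ1 : 0 < 1 + μ := by linarith
  have hT : (fun k : ℕ => CGAL.T f g C (lam k) (x k) (z k)) =O[atTop]
      fun k : ℕ => max ((k : ℝ) ^ (-(1 / (1 + μ)))) ((k : ℝ) ^ (-((2 - 2 * τ) / (1 + μ)))) := by
    -- The exponent `r` is the minimum of `1/(1+μ)` and `(2-2τ)/(1+μ)`.
    refine (halg.T_isBigO hprob hB hC haway hpar hμ ?_ ?_ ?_).trans
      (CGAL.rpow_neg_min_isBigO _ _)
    · exact le_min (by positivity) (div_nonneg (by linarith [hτ.2]) hμ1.le)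
    · rw [← le_div_iff₀ hμ1]
      exact min_le_left _ _
    · rw [← le_div_iff₀ hμ1]
      exact min_le_right _ _
  have hl : (fun k => 1 / lam k) =O[atTop] fun k : ℕ => (k : ℝ) ^ (-τ) := by
    obtain ⟨c, _, hc, _, hlam⟩ := hpar.exists_lam_bounds halg
    refine IsBigO.of_bound c⁻¹ ?_
    filter_upwards [hlam, eventually_ge_atTop 1] with k hk h1
    have hk0 : (0 : ℝ) < k := by exact_mod_cast h1
    have := halg.lam_pos k
    rw [Real.norm_of_nonneg (by positivity), Real.norm_of_nonneg (by positivity),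
      Real.rpow_neg hk0.le, ← mul_inv, ← one_div]
    exact one_div_le_one_div_of_le (by positivity) hk.1
  have hres := halg.residual_isBigO hprob
    (ρ := fun k : ℕ => max (max ((k : ℝ) ^ (-(1 / (1 + μ)))) ((k : ℝ) ^ (-((2 - 2 * τ) / (1 + μ)))))
        ((k : ℝ) ^ (-τ)))
    (hT.trans (IsBigO.of_bound 1 (Eventually.of_forall fun k => by
      rw [one_mul, Real.norm_of_nonneg (by positivity), Real.norm_of_nonneg (by positivity)]
      exact le_max_left _ _)))
    (hl.trans (IsBigO.of_bound 1 (Eventually.of_forall fun k => by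
      rw [one_mul, Real.norm_of_nonneg (by positivity), Real.norm_of_nonneg (by positivity)]
      exact le_max_right _ _)))
  refine ⟨halg.x_mem hprob.C_convex, hT, hres, fun hq hτ2 => hres.trans ?_⟩
  refine IsBigO.of_bound 1 ?_
  filter_upwards [eventually_ge_atTop 1] with k h1
  have hk1 : (1 : ℝ) ≤ k := by exact_mod_cast h1
  rw [one_mul, Real.norm_of_nonneg (by positivity), Real.norm_of_nonneg (by positivity)]
  -- The three exponents become `1`, `2/3` and `2/3`.
  have hμz : μ = 0 := by rw [hμ, hq]; norm_num
  rw [hμz, hτ2]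
  refine max_le (max_le ?_ ?_) le_rfl <;>
    exact Real.rpow_le_rpow_of_exponent_le hk1 (by norm_num)
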